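/- Let $\Omega\subset\mathbb R^N$ ($N\ge 1$) be a bounded open set, let $0\le\nu\le1$, $0<\mu\le1$, $T>0$, and let $A$ be a non-negative self-adjoint operator on the real Hilbert space $L^2(\Omega)$ such that the embedding $D(A)\hookrightarrow L^2(\Omega)$ is compact ($D(A)$ with the graph norm) and all eigenvalues of $A$ are positive. Let $\mathcal E$ be the closed form associated with $A$ (the closure of $(u,w)\mapsto (Au,w)_{L^2(\Omega)}$ on $D(A)$), let $V_{1/2}$ be its domain with the norm $(\|u\|_{L^2(\Omega)}^2+\mathcal E(u,u))^{1/2}$, and let $V_{-1/2}$ be the dual of $V_{1/2}$ with pivot space $L^2(\Omega)$. For $\alpha>0$ put $\mathbb I_{t,T}^{\alpha}u(t)=\frac1{\Gamma(\alpha)}\int_t^T(\tau-t)^{\alpha-1}u(\tau)\,d\tau$, put $\mathbb I_{t,T}^0u=u$, and let $$\mathbb D_{t,T}^{\mu,1-\nu}u=-\,\mathbb I_{t,T}^{(1-\nu)(1-\mu)}\frac{d}{dt}\,\mathbb I_{t,T}^{\nu(1-\mu)}u ,$$ where $\frac{d}{dt}$ is the derivative, in $V_{-1/2}$, of a locally absolutely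 continuous function on $(0,T)$ (one with a locally Bochner integrable derivative of which it is the primitive). Given $v_0\in L^2(\Omega)$, a weak solution of the backward system $$\mathbb D_{t,T}^{\mu,1-\nu}v+Av=0\ \text{ in }\Omega\times(0,T),\qquad \mathbb I_{t,T}^{\nu(1-\mu)}v(\cdot,T)=v_0\ \text{ in }\Omega,$$ is a function $v\in C([0,T);V_{1/2})$ such that $\mathbb I_{t,T}^{\nu(1-\mu)}v$ exists and belongs to $C([0,T];L^2(\Omega))$ (its value at $T$ being its limit as $t\uparrow T$) with value $v_0$ at $T$, $\mathbb D_{t,T}^{\mu,1-\nu}v$ exists and belongs to $C([0,T);V_{-1/2})$, and, for every $\varphi\in V_{1/2}$ and a.e. $t\in(0,T)$, $$\langle \mathbb D_{t,T}^{\mu,1-\nu}v(t),\varphi\rangle_{V_{-1/2},V_{1/2}}+\mathcal E(v(t),\varphi)=0 .$$ Theorem. For every $v_0\in L^2(\Omega)$ the backward system has a unique weak solution $v$ on $[0,T)$. For every orthonormal basis $(\varphi_n)_{n}$ of $L^2(\Omega)$, indexed by the natural numbers, of eigenfunctions of $A$, $A\varphi_n=\lambda_n\varphi_n$, it is given by $$v(\cdot,t)=\sum_{n}(v_0,\varphi_n)_{L^2(\Omega)}\,(T-t)^{-\nu(1-\mu)}E_{\mu,1-\nu(1-\mu)}\big(-\lambda_n(T-t)^\mu\big)\varphi_n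 ,\qquad 0\le t<T,$$ with convergence in $L^2(\Omega)$, where $E_{\alpha,\beta}(x)=\sum_{k=0}^\infty \frac{x^k}{\Gamma(\alpha k+\beta)}$. Moreover, $v:[0,T)\to L^2(\Omega)\subset L^2(\Omega;\mathbb C)$ extends to an analytic function from the half-plane $\{z\in\mathbb C:\operatorname{Re}z<T\}$ to $L^2(\Omega;\mathbb C)$. -/

import Mathlib

open MeasureTheory Set Filter Topology

noncomputable section

namespace HilferAdjoint

/-! ### Mittag-Leffler function, right fractional integrals, right Hilfer derivative -/

/-- The two-parameter Mittag-Leffler function `E_{α,β}(x) = ∑ xⁿ / Γ(α n + β)` for real arguments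
(the series converges absolutely for every `x` when `α > 0`). -/
def mittagLeffler (α β x : ℝ) : ℝ :=
  ∑' n : ℕ, x ^ n / Real.Gamma (α * n + β)

section Fractional

variable {X : Type*} [NormedAddCommGroup X] [NormedSpace ℝ X]

/-- The right Riemann-Liouville fractional integral
`(I_{t,T}^α f)(t) = Γ(α)⁻¹ ∫_t^T (τ - t)^(α-1) f(τ) dτ` for `α > 0`, and `I_{t,T}^0 f = f`.
It is used for `t < T` only; its value at `T` is always understood as the limit as `t ↑ T`. -/
def rightRL (α T : ℝ) (f : ℝ → X) (t : ℝ) : X :=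
  if α = 0 then f t
  else (Real.Gamma α)⁻¹ • ∫ τ in t..T, (τ - t) ^ (α - 1) • f τ

/-- The Bochner integral that defines `(I_{t,T}^α f)(t)` exists. Nothing is required if `α = 0`. -/
def RightRLExists (α T : ℝ) (f : ℝ → X) (t : ℝ) : Prop :=
  α ≠ 0 → IntegrableOn (fun τ : ℝ => (τ - t) ^ (α - 1) • f τ) (Ioo t T) volume

/-- `D` is the right Hilfer derivative of order `(μ, ν)` of `u` on `(0, T)`:
`D = - I_{t,T}^{ν(1-μ)} (d/dt) (I_{t,T}^{(1-ν)(1-μ)} u)`.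
The derivative `d/dt` is the one of locally absolutely continuous functions: `g` is the derivative
of `w` on `(0, T)` if `g` is integrable on compact subintervals and `w t - w s = ∫_s^t g`. Such
a `g` is unique up to null sets, and so is `D`. -/
def HasRightHilferDeriv (μ ν T : ℝ) (u D : ℝ → X) : Prop :=
  (∀ t ∈ Ioo 0 T, RightRLExists ((1 - ν) * (1 - μ)) T u t) ∧
  ∃ g : ℝ → X,
    (∀ s t : ℝ, 0 < s → s ≤ t → t < T →
      IntervalIntegrable g volume s t ∧
      rightRL ((1 - ν) * (1 - μ)) T u t - rightRL ((1 - ν) * (1 - μ)) T u s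
        = ∫ τ in s..t, g τ) ∧
    ∀ᵐ t ∂(volume.restrict (Ioo 0 T)),
      RightRLExists (ν * (1 - μ)) T g t ∧ D t = - rightRL (ν * (1 - μ)) T g t

end Fractional

/-! ### The operator and its form -/

section Operator

variable {H : Type*} [NormedAddCommGroup H] [InnerProductSpace ℝ H] [CompleteSpace H]

/-- The standing assumptions on the operator: `A` is an unbounded operator in `H` that is
self-adjoint (in particular densely defined) and non-negative, the embedding into `H` of its domain
with the graph norm is compact, and all its eigenvalues are positive. The domain with the graph norm
is represented by the graph, a subspace of `H × H`. -/
structure IsAdmissible (A : H →ₗ.[ℝ] H) : Prop where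
  selfAdjoint : IsSelfAdjoint A
  nonneg : ∀ x : A.domain, 0 ≤ inner ℝ (A x) (x : H)
  compact : IsCompactOperator (fun p : A.graph => (p : H × H).1)
  eigenvalue_pos : ∀ (c : ℝ) (x : A.domain), (x : H) ≠ 0 → A x = c • (x : H) → 0 < c

variable {A : H →ₗ.[ℝ] H}

lemma IsAdmissible.symm (hA : IsAdmissible A) (x y : A.domain) :
    inner ℝ (A x) (y : H) = inner ℝ (x : H) (A y) := by
  have hd := hA.selfAdjoint.dense_domain
  have h := LinearPMap.adjoint_isFormalAdjoint hd
  rw [LinearPMap.isSelfAdjoint_def.1 hA.selfAdjoint] at h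
  exact h x y

/-- The inner product `(x, y) + (A x, y)` on `D(A)`. -/
@[reducible] def formInnerCore (hA : IsAdmissible A) : InnerProductSpace.Core ℝ A.domain where
  inner x y := inner ℝ (x : H) (y : H) + inner ℝ (A x) (y : H)
  conj_inner_symm x y := by
    have h := hA.symm x y
    simp only [conj_trivial]
    rw [real_inner_comm, h, real_inner_comm (A y)]
  re_inner_nonneg x := add_nonneg real_inner_self_nonneg (hA.nonneg x)
  add_left x y z := by
    rw [A.map_add, Submodule.coe_add, inner_add_left, inner_add_left]
    ring
  smul_left x y r := by
    rw [A.map_smul, Submodule.coe_smul, real_inner_smul_left, real_inner_smul_left]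
    simp only [conj_trivial]
    ring
  definite x hx := by
    have hx' : inner ℝ (x : H) (x : H) + inner ℝ (A x) (x : H) = 0 := hx
    have h := hA.nonneg x
    have h' := real_inner_self_nonneg (x := (x : H))
    have h0 : inner ℝ (x : H) (x : H) = 0 := by linarith
    exact Subtype.ext (inner_self_eq_zero.1 h0)

/-- A copy of the domain of `A`, equipped with the inner product `(x, y) + (A x, y)`. -/
def FormCore (_hA : IsAdmissible A) : Type _ := A.domain

instance (hA : IsAdmissible A) : AddCommGroup (FormCore hA) :=
  inferInstanceAs (AddCommGroup A.domain)

instance (hA : IsAdmissible A) : Module ℝ (FormCore hA) :=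
  inferInstanceAs (Module ℝ A.domain)

/-- The identity of `D(A)`, as a linear equivalence with the copy that carries the form inner
product. -/
def toFormCore (hA : IsAdmissible A) : A.domain ≃ₗ[ℝ] FormCore hA := LinearEquiv.refl ℝ A.domain

/-- The form inner product, on the copy of `D(A)`. -/
@[reducible] def formCoreCore (hA : IsAdmissible A) : InnerProductSpace.Core ℝ (FormCore hA) :=
  formInnerCore hA

instance (hA : IsAdmissible A) : NormedAddCommGroup (FormCore hA) :=
  (formCoreCore hA).toNormedAddCommGroup

instance (hA : IsAdmissible A) : InnerProductSpace ℝ (FormCore hA) :=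
  InnerProductSpace.ofCore (formCoreCore hA).toCore

lemma formCore_inner (hA : IsAdmissible A) (x y : A.domain) :
    inner ℝ (toFormCore hA x) (toFormCore hA y) = inner ℝ (x : H) (y : H) + inner ℝ (A x) (y : H) :=
  rfl

/-- The inclusion of `D(A)` with the form norm into `H`. -/
def formCoreIncl (hA : IsAdmissible A) : FormCore hA →L[ℝ] H :=
  LinearMap.mkContinuous (A.domain.subtype ∘ₗ (toFormCore hA).symm.toLinearMap) 1 (fun x => by
    obtain ⟨x, rfl⟩ := (toFormCore hA).surjective x
    rw [one_mul]
    refine le_of_sq_le_sq ?_ (norm_nonneg _)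
    rw [← real_inner_self_eq_norm_sq (toFormCore hA x), formCore_inner]
    have h2 := hA.nonneg x
    have h3 := real_inner_self_eq_norm_sq (x : H)
    simp only [LinearMap.comp_apply, LinearEquiv.coe_coe, LinearEquiv.symm_apply_apply,
      Submodule.subtype_apply]
    linarith)

/-- The form domain `V_{1/2}`: the completion of `D(A)` in the norm of `(x, y) + (A x, y)`, a Hilbert
space. -/
abbrev FormDomain (hA : IsAdmissible A) : Type _ := UniformSpace.Completion (FormCore hA)

/-- `D(A) → V_{1/2}`. -/
def ofDomain (hA : IsAdmissible A) (x : A.domain) : FormDomain hA :=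
  ((toFormCore hA x : FormCore hA) : FormDomain hA)

/-- The embedding `V_{1/2} → H`. -/
def incl (hA : IsAdmissible A) : FormDomain hA →L[ℝ] H :=
  (formCoreIncl hA).extend (UniformSpace.Completion.toComplL : FormCore hA →L[ℝ] FormDomain hA)

/-- The closed form `𝓔` on `V_{1/2}` associated with `A`, that is, the closure of `(A x, y)`. -/
def form (hA : IsAdmissible A) (x y : FormDomain hA) : ℝ :=
  inner ℝ x y - inner ℝ (incl hA x) (incl hA y)

lemma incl_ofDomain (hA : IsAdmissible A) (x : A.domain) : incl hA (ofDomain hA x) = (x : H) := by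
  have h := ContinuousLinearMap.extend_eq (formCoreIncl hA)
    (e := (UniformSpace.Completion.toComplL : FormCore hA →L[ℝ] FormDomain hA))
    (UniformSpace.Completion.denseRange_coe)
    (UniformSpace.Completion.isUniformInducing_coe _) (toFormCore hA x)
  exact h

lemma form_ofDomain (hA : IsAdmissible A) (x y : A.domain) :
    form hA (ofDomain hA x) (ofDomain hA y) = inner ℝ (A x) (y : H) := by
  unfold form
  rw [incl_ofDomain, incl_ofDomain]
  unfold ofDomain
  rw [UniformSpace.Completion.inner_coe, formCore_inner]
  ring

/-- `𝓔(x, y) = (x, A y)` for `x ∈ V_{1/2}` and `y ∈ D(A)`. -/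
lemma form_ofDomain_right (hA : IsAdmissible A) (x : FormDomain hA) (y : A.domain) :
    form hA x (ofDomain hA y) = inner ℝ (incl hA x) (A y) := by
  refine UniformSpace.Completion.induction_on x ?_ ?_
  · refine isClosed_eq ?_ ?_
    · unfold form; fun_prop
    · fun_prop
  · intro a
    have h := form_ofDomain hA (show A.domain from a) y
    have h2 := incl_ofDomain hA (show A.domain from a)
    rw [hA.symm] at h
    change form hA (ofDomain hA (show A.domain from a)) _
      = inner ℝ (incl hA (ofDomain hA (show A.domain from a))) _
    rw [h, h2]

/-- The form `(A x, y)` is closable, so that `V_{1/2}` is a subspace of `H`. -/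
lemma incl_injective (hA : IsAdmissible A) : Function.Injective (incl hA) := by
  rw [injective_iff_map_eq_zero]
  intro x hx
  have key : ∀ y : FormDomain hA, inner ℝ x y = 0 := by
    intro y
    refine UniformSpace.Completion.induction_on y ?_ ?_
    · exact isClosed_eq (by fun_prop) (by fun_prop)
    · intro a
      have h := form_ofDomain_right hA x (show A.domain from a)
      unfold form at h
      rw [hx, inner_zero_left, inner_zero_left, sub_zero] at h
      exact h
  exact inner_self_eq_zero.1 (key x)

/-- `V_{-1/2}`, the dual of `V_{1/2}`, with its operator norm. -/
abbrev FormDual (hA : IsAdmissible A) : Type _ := StrongDual ℝ (FormDomain hA)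

/-- The embedding `H → V_{-1/2}`, `x ↦ (φ ↦ (x, φ))`, with `H` as pivot space. -/
def pivot (hA : IsAdmissible A) : H →L[ℝ] FormDual hA :=
  (ContinuousLinearMap.compL ℝ (FormDomain hA) H ℝ).flip (incl hA) ∘L innerSL ℝ

lemma pivot_apply (hA : IsAdmissible A) (x : H) (φ : FormDomain hA) :
    pivot hA x φ = inner ℝ x (incl hA φ) := rfl

/-! ### The backward system -/

/-- `v : [0, T) → V_{1/2}` is a weak solution of the backward system
`D_{t,T}^{μ,1-ν} v + A v = 0` on `(0, T)`, `I_{t,T}^{ν(1-μ)} v (T) = v₀`. Values of `v` outside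
`[0, T)` play no role. The membership `I_{t,T}^{ν(1-μ)} v ∈ C([0,T]; H)` with value `v₀` at `T`
is expressed by continuity on `[0, T)` and the limit `v₀` as `t ↑ T`. -/
structure IsWeakSolution (hA : IsAdmissible A) (μ ν T : ℝ) (v₀ : H) (v : ℝ → FormDomain hA) :
    Prop where
  continuousOn : ContinuousOn v (Ico 0 T)
  integral_exists : ∀ t ∈ Ico 0 T, RightRLExists (ν * (1 - μ)) T (fun τ => incl hA (v τ)) t
  continuousOn_integral :
    ContinuousOn (rightRL (ν * (1 - μ)) T (fun τ => incl hA (v τ))) (Ico 0 T)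
  final : Tendsto (rightRL (ν * (1 - μ)) T (fun τ => incl hA (v τ))) (𝓝[<] T) (𝓝 v₀)
  equation : ∃ D : ℝ → FormDual hA,
    HasRightHilferDeriv μ (1 - ν) T (fun τ => pivot hA (incl hA (v τ))) D ∧
    ContinuousOn D (Ico 0 T) ∧
    ∀ φ : FormDomain hA, ∀ᵐ t ∂(volume.restrict (Ioo 0 T)), D t φ + form hA (v t) φ = 0

/-- `φ` is an orthonormal basis of `H` that consists of eigenvectors of `A`, with `A φ_n = lam n φ_n`. -/
def IsEigenbasis (A : H →ₗ.[ℝ] H) (lam : ℕ → ℝ) (φ : HilbertBasis ℕ ℝ H) : Prop :=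
  ∀ n : ℕ, ∃ h : φ n ∈ A.domain, A ⟨φ n, h⟩ = lam n • φ n

end Operator

/-- The real space `L²(Ω)`. -/
abbrev L2 {N : ℕ} (Ω : Set (EuclideanSpace ℝ (Fin N))) : Type :=
  Lp ℝ 2 (volume.restrict Ω)

/-- The complex space `L²(Ω; ℂ)`. -/
abbrev L2C {N : ℕ} (Ω : Set (EuclideanSpace ℝ (Fin N))) : Type :=
  Lp ℂ 2 (volume.restrict Ω)

/-- The embedding `L²(Ω) ⊆ L²(Ω; ℂ)`. -/
def complexify {N : ℕ} (Ω : Set (EuclideanSpace ℝ (Fin N))) (f : L2 Ω) : L2C Ω :=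
  Complex.ofRealCLM.compLp f

end HilferAdjoint

end

/-! The eigenvectors of `A` diagonalise the system. Put `b = ν(1-μ)` and `a = (1-ν)(1-μ)`, so that
`a + b = 1 - μ`. The coefficient `y` of a weak solution along an eigenvector with eigenvalue `lam`
satisfies `I^a (I^b y)' = lam y`. Integrating up to `T` and using `I^{1-a} I^a = I^1` gives the
Volterra equation `I^b y = y₀ - lam I^{1-a} y`. The function `y₀ s^{-b} E_{μ,1-b}(-lam s^μ)`, `s = T
- t`, solves it. Applying `I^{1-b}` to the difference `z` of two solutions gives `Z = -lam I^μ Z`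
with `Z = I^1 z` bounded, and an exponential weight makes the right side a contraction. This is
`eq_mlFun_of_scalar_equation`; uniqueness and the series follow from it.

For existence the series must converge in `V_{1/2}`, and the derivative of its fractional integral
in `V_{-1/2}`, for each `t < T`. Both reduce by Parseval to bounds on the multipliers that are
uniform in `lam`: `E_{α,β}(-ζ)` must be bounded, and `O(‖ζ‖^{-1/2})` when `β > α/2`. They come from
`mittagLefflerC_neg_eq_integral`, an integral over the line `Re p = 1` whose denominator `p^α + ζ`
has real part at least `Re ζ`, because `α ≤ 1` keeps `p^α` in the right half-plane.

The same bounds hold on complex sectors `‖ζ‖ ≤ K Re ζ`. As `w ↦ lam w^μ` maps a sector of the right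
half-plane into a sector of the same kind, for all `lam ≥ 0` at once, the series of analytic terms
converges locally uniformly on `Re z < T`.

The eigenbasis comes from the spectral theorem for the compact self-adjoint operator `(1 + A)⁻¹`,
built as `incl` composed with its adjoint. -/

noncomputable section

namespace HilferAdjoint

universe u

section

/-! ### The reciprocal Gamma function as an integral over a vertical line -/

/-- The Laplace transform of `s ^ (a - 1)` at a complex point of the right half-plane. -/
lemma integral_rpow_mul_cexp_neg_mul_Ioi {a : ℝ} (ha : 0 < a) {p : ℂ} (hp : 0 < p.re) :
    ∫ s in Ioi (0 : ℝ), ((s ^ (a - 1) : ℝ) : ℂ) * Complex.exp (-p * s)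
      = p ^ (-(a : ℂ)) * Real.Gamma a := by
  have hmeas : ∀ (c : ℝ) (p : ℂ), AEStronglyMeasurable
      (fun s : ℝ => ((s ^ c : ℝ) : ℂ) * Complex.exp (-p * s)) (volume.restrict (Ioi 0)) := by
    intro c p
    refine (Measurable.mul ?_ ?_).aestronglyMeasurable
    · fun_prop
    · fun_prop
  have hnorm : ∀ (c : ℝ) (p : ℂ) (s : ℝ), 0 < s →
      ‖((s ^ c : ℝ) : ℂ) * Complex.exp (-p * s)‖ = s ^ c * Real.exp (-p.re * s) := by
    intro c p s hs
    rw [norm_mul, Complex.norm_exp, Complex.norm_real, Real.norm_of_nonneg (by positivity)]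
    simp
  have hint : ∀ (c r : ℝ), -1 < c → 0 < r →
      IntegrableOn (fun s : ℝ => s ^ c * Real.exp (-r * s)) (Ioi 0) := by
    intro c r hc hr
    have := integrableOn_rpow_mul_exp_neg_mul_rpow (s := c) (p := 1) hc one_pos hr
    simpa using this
  -- Both sides are analytic in `p` on the right half-plane, so it suffices to compare them at
  -- positive reals, where Euler's integral applies.
  have hdiff : DifferentiableOn ℂ
      (fun p : ℂ => ∫ s in Ioi (0 : ℝ), ((s ^ (a - 1) : ℝ) : ℂ) * Complex.exp (-p * s))
      {p | 0 < p.re} := by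
    intro p₀ hp₀
    have hp₀' : 0 < p₀.re := hp₀
    have key := hasDerivAt_integral_of_dominated_loc_of_deriv_le
      (μ := volume.restrict (Ioi (0 : ℝ)))
      (F := fun (p : ℂ) (s : ℝ) => ((s ^ (a - 1) : ℝ) : ℂ) * Complex.exp (-p * s))
      (F' := fun (p : ℂ) (s : ℝ) => ((s ^ (a - 1) : ℝ) : ℂ) * (Complex.exp (-p * s) * (-s)))
      (x₀ := p₀) (s := {p : ℂ | p₀.re / 2 < p.re})
      (bound := fun s : ℝ => s ^ a * Real.exp (-(p₀.re / 2) * s))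
      ((isOpen_lt continuous_const Complex.continuous_re).mem_nhds (by
        change p₀.re / 2 < p₀.re
        linarith))
      (Eventually.of_forall fun p => hmeas _ p) ?_ ?_ ?_ (hint _ _ (by linarith) (by linarith)) ?_
    · exact key.2.differentiableAt.differentiableWithinAt
    · refine Integrable.mono' (hint (a - 1) p₀.re (by linarith) hp₀') (hmeas _ _) ?_
      filter_upwards [ae_restrict_mem measurableSet_Ioi] with s hs
      exact (hnorm _ _ _ hs).le
    · refine (Measurable.mul ?_ ?_).aestronglyMeasurable
      · fun_prop
      · fun_prop
    · filter_upwards [ae_restrict_mem measurableSet_Ioi] with s hs p hp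
      have hs : 0 < s := hs
      have hp : p₀.re / 2 < p.re := hp
      rw [← mul_assoc, norm_mul, hnorm _ _ _ hs, norm_neg, Complex.norm_real,
        Real.norm_of_nonneg hs.le, mul_right_comm]
      have h1 : s ^ (a - 1) * s = s ^ a := by
        rw [← Real.rpow_add_one hs.ne']
        ring_nf
      rw [h1]
      gcongr
    · refine Eventually.of_forall fun s p _ => ?_
      have h1 : HasDerivAt (fun p : ℂ => -p * (s : ℂ)) (-(s : ℂ)) p := by
        simpa using (hasDerivAt_id p).neg.mul_const (s : ℂ)
      exact (h1.cexp).const_mul _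
  have hopen : IsOpen {p : ℂ | 0 < p.re} := isOpen_lt continuous_const Complex.continuous_re
  have hdiff2 : DifferentiableOn ℂ (fun p : ℂ => p ^ (-(a : ℂ)) * Real.Gamma a) {p | 0 < p.re} := by
    intro p hp
    have hp : 0 < p.re := hp
    refine DifferentiableAt.differentiableWithinAt ?_
    exact ((hasDerivAt_id p).cpow_const (Or.inl hp)).differentiableAt.mul_const _
  have hconv : Convex ℝ {p : ℂ | 0 < p.re} := convex_halfSpace_re_gt 0
  refine (hdiff.analyticOnNhd hopen).eqOn_of_preconnected_of_frequently_eq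
    (hdiff2.analyticOnNhd hopen) hconv.isPreconnected (z₀ := 1) (by simp) ?_ hp
  have hreal : ∀ r : ℝ, 0 < r →
      (∫ s in Ioi (0 : ℝ), ((s ^ (a - 1) : ℝ) : ℂ) * Complex.exp (-(r : ℂ) * s))
        = (r : ℂ) ^ (-(a : ℂ)) * Real.Gamma a := by
    intro r hr
    have h := Real.integral_rpow_mul_exp_neg_mul_Ioi ha hr
    have h2 : (r : ℂ) ^ (-(a : ℂ)) * Real.Gamma a = (((1 / r) ^ a * Real.Gamma a : ℝ) : ℂ) := by
      rw [one_div, Real.inv_rpow hr.le, ← Real.rpow_neg hr.le]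
      push_cast
      rw [Complex.ofReal_cpow hr.le]
      push_cast
      rfl
    rw [h2, ← h, ← integral_complex_ofReal]
    refine integral_congr_ae (Eventually.of_forall fun s => ?_)
    push_cast
    ring_nf
  -- The identity theorem needs points of agreement that accumulate at `1` without being `1`.
  have hlim : Tendsto (fun n : ℕ => (((1 + 1 / ((n : ℝ) + 1) : ℝ)) : ℂ)) atTop (𝓝[≠] 1) := by
    refine tendsto_nhdsWithin_iff.2 ⟨?_, Eventually.of_forall fun n => ?_⟩
    · have h := (tendsto_one_div_add_atTop_nhds_zero_nat (𝕜 := ℝ)).const_add 1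
      rw [add_zero] at h
      exact_mod_cast (Complex.continuous_ofReal.tendsto 1).comp h
    · have : (1 : ℝ) / ((n : ℝ) + 1) ≠ 0 := by positivity
      intro h
      have h' : ((1 + 1 / ((n : ℝ) + 1) : ℝ) : ℂ) = ((1 : ℝ) : ℂ) := by simpa using h
      have := Complex.ofReal_injective h'
      simp_all
  refine hlim.frequently (Eventually.frequently (Eventually.of_forall fun n => ?_))
  exact hreal _ (by positivity)

/-! ### Integrals over the line `Re p = 1` -/

/-- The point `1 + 2 π i y` of the line `Re p = 1`. -/
def vline (y : ℝ) : ℂ := 1 + 2 * Real.pi * y * Complex.I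

@[simp] lemma vline_re (y : ℝ) : (vline y).re = 1 := by
  simp [vline]

@[fun_prop] lemma continuous_vline : Continuous vline := by
  unfold vline
  fun_prop

lemma vline_ne_zero (y : ℝ) : vline y ≠ 0 := by
  intro h
  have := vline_re y
  rw [h] at this
  simp at this

lemma one_le_norm_vline (y : ℝ) : 1 ≤ ‖vline y‖ := by
  have := Complex.abs_re_le_norm (vline y)
  simpa using this

lemma one_add_le_norm_vline (y : ℝ) : 1 + |y| ≤ 2 * ‖vline y‖ := by
  have h1 := one_le_norm_vline y
  have h2 := Complex.abs_im_le_norm (vline y)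
  have h3 : (vline y).im = 2 * Real.pi * y := by simp [vline]
  rw [h3, abs_mul, abs_of_pos (by positivity)] at h2
  have h4 : 1 ≤ 2 * Real.pi := by linarith [Real.pi_gt_three]
  nlinarith [abs_nonneg y]

lemma integrable_norm_vline_rpow {a : ℝ} (ha : 1 < a) :
    Integrable (fun y : ℝ => ‖vline y‖ ^ (-a)) := by
  have h := (integrable_one_add_norm (E := ℝ) (μ := volume) (r := a) (by simpa using ha)).const_mul
    ((1 / 2 : ℝ) ^ (-a))
  refine h.mono' ?_ (Eventually.of_forall fun y => ?_)
  · refine Continuous.aestronglyMeasurable ?_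
    refine (continuous_vline.norm).rpow_const fun y => Or.inl ?_
    exact (norm_pos_iff.2 (vline_ne_zero y)).ne'
  · rw [Real.norm_of_nonneg (by positivity), ← Real.mul_rpow (by norm_num) (by positivity)]
    refine Real.rpow_le_rpow_of_nonpos (by positivity) ?_ (by linarith)
    have := one_add_le_norm_vline y
    rw [Real.norm_eq_abs]
    linarith

lemma norm_vline_cpow (y a : ℝ) : ‖vline y ^ (a : ℂ)‖ = ‖vline y‖ ^ a := by
  rw [Complex.norm_cpow_real]

lemma norm_exp_vline (y : ℝ) : ‖Complex.exp (vline y)‖ = Real.exp 1 := by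
  rw [Complex.norm_exp, vline_re]

lemma continuous_vline_cpow (a : ℂ) : Continuous (fun y : ℝ => vline y ^ a) := by
  refine continuous_vline.cpow continuous_const fun y => Or.inl ?_
  simp

/-- The inverse Laplace transform of `p ^ (-a)`, evaluated at `1`. -/
lemma integral_exp_mul_vline_cpow {a : ℝ} (ha : 1 < a) :
    ∫ y : ℝ, Complex.exp (vline y) * vline y ^ (-(a : ℂ)) = 1 / Real.Gamma a := by
  -- The Fourier transform of this function at `y` is its undamped factor's Laplace transform at
  -- `vline y`; hence the `2π` in `vline`. Since `a > 1` the transform is integrable, and Fourier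
  -- inversion at `s = 1` gives the claim.
  set f : ℝ → ℂ := (Ioi (0 : ℝ)).indicator
    (fun s : ℝ => ((s ^ (a - 1) : ℝ) : ℂ) * Complex.exp (-s)) with hf
  have hG : (Real.Gamma a : ℂ) ≠ 0 := by
    exact_mod_cast (Real.Gamma_pos_of_pos (by linarith)).ne'
  have hfi : Integrable f := by
    rw [hf, integrable_indicator_iff measurableSet_Ioi]
    have h := (Real.GammaIntegral_convergent (s := a) (by linarith)).ofReal (𝕜 := ℂ)
    refine h.congr (Eventually.of_forall fun s => ?_)
    simp
    ring
  have hF : FourierTransform.fourier f = fun y => vline y ^ (-(a : ℂ)) * Real.Gamma a := by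
    funext y
    rw [Real.fourier_real_eq, ← integral_rpow_mul_cexp_neg_mul_Ioi (by linarith) (by simp),
      ← integral_indicator measurableSet_Ioi]
    refine integral_congr_ae (Eventually.of_forall fun s => ?_)
    simp only [hf, indicator]
    split_ifs with hs
    · rw [Circle.smul_def, Real.fourierChar_apply, smul_eq_mul, mul_left_comm, ← Complex.exp_add]
      congr 2
      unfold vline
      push_cast
      ring
    · simp
  have hFi : Integrable (FourierTransform.fourier f) := by
    rw [hF]
    refine Integrable.mul_const ?_ _
    refine (integrable_norm_vline_rpow ha).mono' (continuous_vline_cpow _).aestronglyMeasurable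
      (Eventually.of_forall fun y => ?_)
    have := norm_vline_cpow y (-a)
    push_cast at this
    exact this.le
  have hc : ContinuousAt f 1 := by
    have h1 : ContinuousAt (fun s : ℝ => ((s ^ (a - 1) : ℝ) : ℂ) * Complex.exp (-s)) 1 := by
      have : ContinuousAt (fun s : ℝ => s ^ (a - 1)) 1 :=
        Real.continuousAt_rpow_const _ _ (Or.inl one_ne_zero)
      fun_prop
    refine h1.congr ?_
    filter_upwards [Ioi_mem_nhds (zero_lt_one' ℝ)] with s hs
    simp [hf, mem_Ioi.1 hs]
  have hinv := hfi.fourierInv_fourier_eq hFi hc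
  rw [hF, Real.fourierInv_eq] at hinv
  have hf1 : f 1 = Complex.exp (-1) := by simp [hf]
  rw [hf1] at hinv
  have h2 : ∀ y : ℝ, Real.fourierChar (inner ℝ y 1) • (vline y ^ (-(a : ℂ)) * (Real.Gamma a : ℂ))
      = (Real.Gamma a * Complex.exp (-1)) * (Complex.exp (vline y) * vline y ^ (-(a : ℂ))) := by
    intro y
    have : Complex.exp (vline y)
        = Complex.exp 1 * Complex.exp (((2 * Real.pi * y : ℝ) : ℂ) * Complex.I) := by
      rw [← Complex.exp_add]
      congr 1
      unfold vline
      push_cast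
      ring
    have hi : inner ℝ y (1 : ℝ) = y := by simp
    rw [Circle.smul_def, Real.fourierChar_apply, smul_eq_mul, this, Complex.exp_neg, hi]
    field_simp [Complex.exp_ne_zero]
  simp_rw [h2] at hinv
  rw [integral_const_mul] at hinv
  have he := Complex.exp_ne_zero (-1)
  rw [eq_div_iff hG]
  have h3 : Complex.exp (-1) * ((∫ y : ℝ, Complex.exp (vline y) * vline y ^ (-(a : ℂ)))
      * Real.Gamma a) = Complex.exp (-1) * 1 := by
    rw [mul_one]
    conv_rhs => rw [← hinv]
    ring
  exact mul_left_cancel₀ he h3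

end

section

/-! ### The Mittag-Leffler function of a complex variable -/

/-- The two-parameter Mittag-Leffler function of a complex variable. -/
def mittagLefflerC (α β : ℝ) (z : ℂ) : ℂ :=
  ∑' n : ℕ, z ^ n / (Real.Gamma (α * n + β) : ℂ)

/-- In Euler's integral only the tail `x > R` is kept, where `x^(z-1) ≥ R^(z-1)`. As `R` is free,
Gamma outgrows every geometric sequence. -/
lemma rpow_le_exp_mul_Gamma {R z : ℝ} (hR : 0 < R) (hz : 1 ≤ z) :
    R ^ (z - 1) ≤ Real.exp R * Real.Gamma z := by
  have h1 : ∫ x in Ioi R, Real.exp (-x) * R ^ (z - 1) ≤ Real.Gamma z := by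
    rw [Real.Gamma_eq_integral (by linarith)]
    have hi := Real.GammaIntegral_convergent (s := z) (by linarith)
    calc ∫ x in Ioi R, Real.exp (-x) * R ^ (z - 1)
        ≤ ∫ x in Ioi R, Real.exp (-x) * x ^ (z - 1) := by
          refine setIntegral_mono_on ((integrableOn_exp_neg_Ioi R).mul_const _)
            (hi.mono_set (Ioi_subset_Ioi hR.le)) measurableSet_Ioi fun x hx => ?_
          have hx : R < x := hx
          have : 0 ≤ z - 1 := by linarith
          gcongr
      _ ≤ _ := by
          refine setIntegral_mono_set hi ?_ (Ioi_subset_Ioi hR.le).eventuallyLE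
          filter_upwards [ae_restrict_mem measurableSet_Ioi] with x hx
          have hx : 0 < x := hx
          positivity
  rw [integral_mul_const, integral_exp_neg_Ioi] at h1
  calc R ^ (z - 1) = Real.exp R * (Real.exp (-R) * R ^ (z - 1)) := by
        rw [← mul_assoc, ← Real.exp_add]
        simp
    _ ≤ _ := by gcongr

variable {α β : ℝ}

lemma mittagLeffler_Gamma_pos (hα : 0 < α) (hβ : 0 < β) (n : ℕ) :
    0 < Real.Gamma (α * n + β) :=
  Real.Gamma_pos_of_pos (by positivity)

lemma summable_mittagLeffler_norm (hα : 0 < α) (hβ : 0 < β) {r : ℝ} (hr : 0 ≤ r) :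
    Summable (fun n : ℕ => r ^ n / Real.Gamma (α * n + β)) := by
  -- With `R^α = 2(r+1)` the `n`-th term is eventually at most a constant times `2^{-n}`.
  set R : ℝ := (2 * (r + 1)) ^ (1 / α) with hR
  have hRpos : 0 < R := by positivity
  have hRα : R ^ α = 2 * (r + 1) := by
    rw [hR, ← Real.rpow_mul (by positivity)]
    field_simp
    simp
  refine Summable.of_norm_bounded_eventually_nat
    (g := fun n : ℕ => Real.exp R * R ^ (1 - β) * (1 / 2 : ℝ) ^ n)
    ((summable_geometric_of_lt_one (by norm_num) (by norm_num)).mul_left _) ?_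
  have hev : ∀ᶠ n : ℕ in atTop, 1 ≤ α * n + β := by
    have : Tendsto (fun n : ℕ => α * (n : ℝ) + β) atTop atTop :=
      tendsto_atTop_add_const_right _ _ (tendsto_natCast_atTop_atTop.const_mul_atTop hα)
    exact this.eventually_ge_atTop 1
  filter_upwards [hev] with n hn
  have hG := mittagLeffler_Gamma_pos hα hβ n
  rw [Real.norm_of_nonneg (by positivity), div_le_iff₀ hG]
  have h := rpow_le_exp_mul_Gamma hRpos hn
  have h2 : R ^ (α * n + β - 1) = (2 * (r + 1)) ^ n * R ^ (β - 1) := by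
    rw [add_sub_assoc, Real.rpow_add hRpos, Real.rpow_mul hRpos.le, hRα, Real.rpow_natCast]
  have h3 : R ^ (1 - β) * R ^ (β - 1) = 1 := by
    rw [← Real.rpow_add hRpos]
    simp
  calc r ^ n ≤ (r + 1) ^ n := by gcongr; linarith
    _ = R ^ (1 - β) * (1 / 2 : ℝ) ^ n * ((2 * (r + 1)) ^ n * R ^ (β - 1)) := by
        have h4 : (1 / 2 : ℝ) ^ n * (2 * (r + 1)) ^ n = (r + 1) ^ n := by
          rw [← mul_pow]
          ring_nf
        rw [← h4]
        linear_combination (-(1 / 2 : ℝ) ^ n * (2 * (r + 1)) ^ n) * h3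
    _ ≤ R ^ (1 - β) * (1 / 2 : ℝ) ^ n * (Real.exp R * Real.Gamma (α * n + β)) := by
        rw [← h2]
        gcongr
    _ = _ := by ring

lemma norm_mittagLefflerC_term (hα : 0 < α) (hβ : 0 < β) (z : ℂ) (n : ℕ) :
    ‖z ^ n / (Real.Gamma (α * n + β) : ℂ)‖ = ‖z‖ ^ n / Real.Gamma (α * n + β) := by
  rw [norm_div, norm_pow, Complex.norm_real,
    Real.norm_of_nonneg (mittagLeffler_Gamma_pos hα hβ n).le]

lemma hasSum_mittagLefflerC (hα : 0 < α) (hβ : 0 < β) (z : ℂ) :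
    HasSum (fun n : ℕ => z ^ n / (Real.Gamma (α * n + β) : ℂ)) (mittagLefflerC α β z) := by
  refine Summable.hasSum (Summable.of_norm ?_)
  simp_rw [norm_mittagLefflerC_term hα hβ]
  exact summable_mittagLeffler_norm hα hβ (norm_nonneg z)

lemma hasSum_mittagLeffler (hα : 0 < α) (hβ : 0 < β) (x : ℝ) :
    HasSum (fun n : ℕ => x ^ n / Real.Gamma (α * n + β)) (mittagLeffler α β x) := by
  refine Summable.hasSum (Summable.of_norm ?_)
  refine (summable_mittagLeffler_norm hα hβ (abs_nonneg x)).congr fun n => ?_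
  rw [norm_div, norm_pow, Real.norm_eq_abs,
    Real.norm_of_nonneg (mittagLeffler_Gamma_pos hα hβ n).le]

lemma mittagLefflerC_ofReal (α β x : ℝ) :
    mittagLefflerC α β (x : ℂ) = (mittagLeffler α β x : ℂ) := by
  unfold mittagLefflerC mittagLeffler
  push_cast
  rfl

lemma differentiable_mittagLefflerC (hα : 0 < α) (hβ : 0 < β) :
    Differentiable ℂ (mittagLefflerC α β) := by
  intro z
  have h : DifferentiableOn ℂ (mittagLefflerC α β) (Metric.ball 0 (‖z‖ + 1)) := by
    refine Complex.differentiableOn_tsum_of_summable_norm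
      (u := fun n : ℕ => (‖z‖ + 1) ^ n / Real.Gamma (α * n + β))
      (summable_mittagLeffler_norm hα hβ (by positivity)) (fun n => ?_) Metric.isOpen_ball ?_
    · fun_prop
    · intro n w hw
      rw [norm_mittagLefflerC_term hα hβ]
      have hw : ‖w‖ < ‖z‖ + 1 := by simpa using hw
      have := mittagLeffler_Gamma_pos hα hβ n
      gcongr
  exact h.differentiableAt (Metric.isOpen_ball.mem_nhds (by simp))

lemma continuous_mittagLeffler (hα : 0 < α) (hβ : 0 < β) : Continuous (mittagLeffler α β) := by
  have h : mittagLeffler α β = fun x : ℝ => (mittagLefflerC α β (x : ℂ)).re := by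
    funext x
    rw [mittagLefflerC_ofReal, Complex.ofReal_re]
  rw [h]
  exact Complex.continuous_re.comp
    ((differentiable_mittagLefflerC hα hβ).continuous.comp Complex.continuous_ofReal)

lemma mittagLeffler_zero_right (hα : 0 < α) (hβ : 0 < β) :
    mittagLeffler α β 0 = (Real.Gamma β)⁻¹ := by
  refine (hasSum_mittagLeffler hα hβ 0).unique ?_
  convert hasSum_ite_eq (0 : ℕ) ((Real.Gamma β)⁻¹) using 2 with n
  split_ifs with h
  · subst h
    simp
  · simp [h]

/-- The first term of the series split off. -/
lemma mittagLeffler_eq_add (hα : 0 < α) (hβ : 0 < β) (x : ℝ) :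
    mittagLeffler α β x = (Real.Gamma β)⁻¹ + x * mittagLeffler α (α + β) x := by
  have h1 := hasSum_mittagLeffler hα hβ x
  have h2 := (hasSum_mittagLeffler hα (add_pos hα hβ) x).mul_left x
  have h3 := (hasSum_nat_add_iff' 1).2 h1
  have h4 := h3.unique (a₂ := x * mittagLeffler α (α + β) x) (by
    refine h2.congr_fun fun n => ?_
    push_cast
    rw [pow_succ]
    ring_nf)
  simp at h4
  linarith

/-! ### Powers of points of the right half-plane -/

/-- The argument of `p^α` is `α arg p`, and `cos (α θ) ≥ cos θ = Re p / ‖p‖` for `|θ| < π/2`. Thus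
such powers preserve sectors of the right half-plane. -/
lemma le_re_cpow {p : ℂ} (hp : 0 < p.re) (hα : 0 ≤ α) (hα1 : α ≤ 1) :
    p.re / ‖p‖ * ‖p ^ (α : ℂ)‖ ≤ (p ^ (α : ℂ)).re := by
  have hp0 : p ≠ 0 := by
    rintro rfl
    simp at hp
  rw [Complex.cpow_ofReal_re, Complex.norm_cpow_real, mul_comm, ← Complex.cos_arg hp0]
  have harg := Complex.abs_arg_lt_pi_div_two_iff.2 (Or.inl hp)
  gcongr
  rw [← Real.cos_abs p.arg, ← Real.cos_abs (p.arg * α), abs_mul, abs_of_nonneg hα]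
  refine Real.cos_le_cos_of_nonneg_of_le_pi (by positivity) (by linarith [Real.pi_pos]) ?_
  exact mul_le_of_le_one_right (abs_nonneg _) hα1

lemma re_cpow_nonneg {p : ℂ} (hp : 0 < p.re) (hα : 0 ≤ α) (hα1 : α ≤ 1) :
    0 ≤ (p ^ (α : ℂ)).re := by
  refine le_trans ?_ (le_re_cpow hp hα hα1)
  positivity

end

section

variable {α β : ℝ}

/-! ### Integral representation of the Mittag-Leffler function on the left half-plane -/

/-- The quotient `p ^ α / (p ^ α + ζ)` on the line `Re p = 1`. -/
def mlQuot (α : ℝ) (ζ : ℂ) (y : ℝ) : ℂ := vline y ^ (α : ℂ) / (vline y ^ (α : ℂ) + ζ)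

/-- The integrand in the representation of `E_{α,β}(-ζ)`. -/
def mlKernel (α β : ℝ) (ζ : ℂ) (y : ℝ) : ℂ :=
  Complex.exp (vline y) * vline y ^ (-((β + 1 : ℝ) : ℂ))
    * ((β - α) * mlQuot α ζ y + α * mlQuot α ζ y ^ 2)

lemma re_vline_cpow_nonneg (hα : 0 ≤ α) (hα1 : α ≤ 1) (y : ℝ) : 0 ≤ (vline y ^ (α : ℂ)).re :=
  re_cpow_nonneg (by simp) hα hα1

lemma vline_cpow_ne_zero (y : ℝ) (a : ℂ) : vline y ^ a ≠ 0 := by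
  rw [Complex.cpow_ne_zero_iff]
  exact Or.inl (vline_ne_zero y)

lemma re_le_norm_vline_cpow_add (hα : 0 ≤ α) (hα1 : α ≤ 1) (ζ : ℂ) (y : ℝ) :
    ζ.re ≤ ‖vline y ^ (α : ℂ) + ζ‖ := by
  have h1 := re_vline_cpow_nonneg hα hα1 y
  have h2 := Complex.re_le_norm (vline y ^ (α : ℂ) + ζ)
  rw [Complex.add_re] at h2
  linarith

lemma vline_cpow_add_ne_zero (hα : 0 ≤ α) (hα1 : α ≤ 1) {ζ : ℂ} (hζ : 0 < ζ.re) (y : ℝ) :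
    vline y ^ (α : ℂ) + ζ ≠ 0 := by
  rw [← norm_pos_iff]
  exact hζ.trans_le (re_le_norm_vline_cpow_add hα hα1 ζ y)

/-- The denominator dominates `Re ζ`, hence `‖ζ‖ / K`; the numerator is the denominator minus `ζ`.
-/
lemma norm_mlQuot_le (hα : 0 ≤ α) (hα1 : α ≤ 1) {ζ : ℂ} (hζ : 0 < ζ.re) (y : ℝ) {K : ℝ}
    (hK : ‖ζ‖ ≤ K * ζ.re) : ‖mlQuot α ζ y‖ ≤ 1 + K := by
  have h1 := re_le_norm_vline_cpow_add hα hα1 ζ y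
  have hK0 : 0 ≤ K := by
    by_contra h
    nlinarith [norm_nonneg ζ]
  rw [mlQuot, norm_div, div_le_iff₀ (hζ.trans_le h1)]
  calc ‖vline y ^ (α : ℂ)‖ = ‖(vline y ^ (α : ℂ) + ζ) - ζ‖ := by rw [add_sub_cancel_right]
    _ ≤ ‖vline y ^ (α : ℂ) + ζ‖ + ‖ζ‖ := norm_sub_le _ _
    _ ≤ ‖vline y ^ (α : ℂ) + ζ‖ + K * ‖vline y ^ (α : ℂ) + ζ‖ := by
        gcongr
        exact hK.trans (by gcongr)
    _ = _ := by ring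

/-- After squaring, one factor of the quotient is bounded by `1 + K`, and the other cancels the
denominator that dominates `‖ζ‖ / K`. The price is a growth `‖p‖^{α/2}` along the line, which the
factor `p^{-(β+1)}` absorbs when `β > α/2`. -/
lemma norm_mlQuot_mul_sqrt_le (hα : 0 ≤ α) (hα1 : α ≤ 1) {ζ : ℂ} (hζ : 0 < ζ.re) (y : ℝ) {K : ℝ}
    (hK : ‖ζ‖ ≤ K * ζ.re) :
    ‖mlQuot α ζ y‖ * √‖ζ‖ ≤ √(K * (1 + K)) * ‖vline y‖ ^ (α / 2) := by
  have h1 := re_le_norm_vline_cpow_add hα hα1 ζ y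
  have hθ := norm_mlQuot_le hα hα1 hζ y hK
  have hK0 : 0 ≤ K := by
    by_contra h
    nlinarith [norm_nonneg ζ]
  have hv : ‖vline y‖ ^ (α / 2) = √(‖vline y ^ (α : ℂ)‖) := by
    rw [norm_vline_cpow, Real.sqrt_eq_rpow, ← Real.rpow_mul (norm_nonneg _)]
    ring_nf
  rw [hv, ← Real.sqrt_mul (by positivity)]
  refine Real.le_sqrt_of_sq_le ?_
  rw [mul_pow, Real.sq_sqrt (norm_nonneg _)]
  have h2 : ‖mlQuot α ζ y‖ * ‖vline y ^ (α : ℂ) + ζ‖ = ‖vline y ^ (α : ℂ)‖ := by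
    rw [mlQuot, norm_div, div_mul_cancel₀]
    exact (hζ.trans_le h1).ne'
  calc ‖mlQuot α ζ y‖ ^ 2 * ‖ζ‖ ≤ ‖mlQuot α ζ y‖ ^ 2 * (K * ‖vline y ^ (α : ℂ) + ζ‖) := by
        gcongr
        exact hK.trans (by gcongr)
    _ = K * ‖mlQuot α ζ y‖ * ‖vline y ^ (α : ℂ)‖ := by rw [← h2]; ring
    _ ≤ K * (1 + K) * ‖vline y ^ (α : ℂ)‖ := by gcongr

lemma continuous_mlQuot (hα : 0 ≤ α) (hα1 : α ≤ 1) {ζ : ℂ} (hζ : 0 < ζ.re) :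
    Continuous (mlQuot α ζ) :=
  (continuous_vline_cpow _).div ((continuous_vline_cpow _).add continuous_const)
    (vline_cpow_add_ne_zero hα hα1 hζ)

lemma continuous_mlKernel (hα : 0 ≤ α) (hα1 : α ≤ 1) {ζ : ℂ} (hζ : 0 < ζ.re) :
    Continuous (mlKernel α β ζ) := by
  have h1 := continuous_mlQuot hα hα1 hζ
  have h2 := continuous_vline_cpow (-((β + 1 : ℝ) : ℂ))
  unfold mlKernel
  fun_prop

lemma norm_exp_mul_vline_cpow (a y : ℝ) :
    ‖Complex.exp (vline y) * vline y ^ (-(a : ℂ))‖ = Real.exp 1 * ‖vline y‖ ^ (-a) := by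
  have h := norm_vline_cpow y (-a)
  push_cast at h
  rw [norm_mul, norm_exp_vline, h]

lemma norm_mlKernel_le (hα : 0 ≤ α) (hα1 : α ≤ 1) {ζ : ℂ} (hζ : 0 < ζ.re) (y : ℝ) {K : ℝ}
    (hK : ‖ζ‖ ≤ K * ζ.re) :
    ‖mlKernel α β ζ y‖
      ≤ Real.exp 1 * ‖vline y‖ ^ (-(β + 1)) * ((|β - α| + α * (1 + K)) * ‖mlQuot α ζ y‖) := by
  have hθ := norm_mlQuot_le hα hα1 hζ y hK
  rw [mlKernel, norm_mul, norm_exp_mul_vline_cpow]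
  gcongr
  calc ‖((β : ℂ) - α) * mlQuot α ζ y + α * mlQuot α ζ y ^ 2‖
      ≤ ‖((β : ℂ) - α) * mlQuot α ζ y‖ + ‖(α : ℂ) * mlQuot α ζ y ^ 2‖ := norm_add_le _ _
    _ = |β - α| * ‖mlQuot α ζ y‖ + α * (‖mlQuot α ζ y‖ * ‖mlQuot α ζ y‖) := by
        rw [norm_mul, norm_mul, norm_pow, ← Complex.ofReal_sub, Complex.norm_real,
          Complex.norm_real, Real.norm_eq_abs, Real.norm_of_nonneg hα, sq]
    _ ≤ |β - α| * ‖mlQuot α ζ y‖ + α * ((1 + K) * ‖mlQuot α ζ y‖) := by gcongr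
    _ = _ := by ring

lemma integrable_mlKernel (hα : 0 ≤ α) (hα1 : α ≤ 1) (hβ : 0 < β) {ζ : ℂ} (hζ : 0 < ζ.re) :
    Integrable (mlKernel α β ζ) := by
  have hK : ‖ζ‖ ≤ ‖ζ‖ / ζ.re * ζ.re := by rw [div_mul_cancel₀ _ hζ.ne']
  refine (((integrable_norm_vline_rpow (a := β + 1) (by linarith)).const_mul
    (Real.exp 1)).mul_const ((|β - α| + α * (1 + ‖ζ‖ / ζ.re)) * (1 + ‖ζ‖ / ζ.re))).mono'
      (continuous_mlKernel hα hα1 hζ).aestronglyMeasurable (Eventually.of_forall fun y => ?_)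
  refine (norm_mlKernel_le hα hα1 hζ y hK).trans ?_
  have hθ := norm_mlQuot_le hα hα1 hζ y hK
  gcongr

/-- The representation for `‖ζ‖ < 1`, by expansion in a geometric series. -/
lemma mittagLefflerC_neg_eq_integral_of_norm_lt (hα : 0 < α) (hβ : 0 < β) {ζ : ℂ}
    (hζ1 : ‖ζ‖ < 1) : mittagLefflerC α β (-ζ) = ∫ y, mlKernel α β ζ y := by
  -- Writing `1/Γ(x) = x/Γ(x+1)` with `x = αn + β` gives the power of `p` an integrable exponent for
  -- every `β > 0`. The factor `αn + β` then turns the geometric series with ratio `-ζ/p^α` and sum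
  -- `θ` into `(β-α)θ + αθ²`, which is why `mlKernel` is quadratic in `mlQuot`.
  set F : ℕ → ℝ → ℂ := fun n y => ((-ζ) ^ n * (α * n + β)) *
    (Complex.exp (vline y) * vline y ^ (-((α * n + β + 1 : ℝ) : ℂ))) with hF
  have hFnorm : ∀ n y, ‖F n y‖
      ≤ (‖ζ‖ ^ n * (α * n + β)) * (Real.exp 1 * ‖vline y‖ ^ (-(β + 1))) := by
    intro n y
    have h1 : ‖((-ζ) ^ n * ((α : ℂ) * n + β))‖ = ‖ζ‖ ^ n * (α * n + β) := by
      have : ((α : ℂ) * n + β) = ((α * n + β : ℝ) : ℂ) := by push_cast; rfl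
      rw [norm_mul, norm_pow, norm_neg, this, Complex.norm_real,
        Real.norm_of_nonneg (by positivity)]
    simp only [hF]
    rw [norm_mul, norm_exp_mul_vline_cpow, h1]
    have := one_le_norm_vline y
    have h2 : 0 ≤ α * n := by positivity
    gcongr
    linarith
  have hbi : Integrable (fun y => Real.exp 1 * ‖vline y‖ ^ (-(β + 1))) :=
    (integrable_norm_vline_rpow (a := β + 1) (by linarith)).const_mul _
  have hFi : ∀ n, Integrable (F n) := by
    intro n
    refine (hbi.const_mul (‖ζ‖ ^ n * (α * n + β))).mono' ?_ (Eventually.of_forall (hFnorm n))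
    refine Continuous.aestronglyMeasurable ?_
    have := continuous_vline_cpow (-((α * n + β + 1 : ℝ) : ℂ))
    simp only [hF]
    fun_prop
  have hsum : Summable (fun n : ℕ => ‖ζ‖ ^ n * (α * n + β)) := by
    have h1 := (hasSum_coe_mul_geometric_of_norm_lt_one (r := ‖ζ‖) (by simpa using hζ1)).summable
    have h2 := summable_geometric_of_lt_one (norm_nonneg ζ) hζ1
    refine ((h1.mul_left α).add (h2.mul_left β)).congr fun n => ?_
    ring
  have key := hasSum_integral_of_summable_integral_norm hFi (by
    refine Summable.of_nonneg_of_le (fun n => integral_nonneg fun y => norm_nonneg _) (fun n => ?_)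
      (hsum.mul_right (∫ y, Real.exp 1 * ‖vline y‖ ^ (-(β + 1))))
    rw [← integral_const_mul]
    exact integral_mono (hFi n).norm (hbi.const_mul _) (hFnorm n))
  have h1 : ∀ n, ∫ y, F n y = (-ζ) ^ n / (Real.Gamma (α * n + β) : ℂ) := by
    intro n
    have hp : 0 < α * n + β := by positivity
    simp only [hF]
    rw [integral_const_mul, integral_exp_mul_vline_cpow (by linarith), Real.Gamma_add_one hp.ne']
    have h2 : (α : ℂ) * n + β ≠ 0 := by exact_mod_cast hp.ne'
    have h3 : (Real.Gamma (α * n + β) : ℂ) ≠ 0 := by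
      exact_mod_cast (mittagLeffler_Gamma_pos hα hβ n).ne'
    push_cast
    field_simp
  have h2 : ∀ y, ∑' n, F n y = mlKernel α β ζ y := by
    intro y
    set q := vline y ^ (α : ℂ) with hq
    have hq0 : q ≠ 0 := vline_cpow_ne_zero y _
    have hq1 : 1 ≤ ‖q‖ := by
      rw [hq, norm_vline_cpow]
      exact Real.one_le_rpow (one_le_norm_vline y) hα.le
    have hx : ‖-ζ / q‖ < 1 := by
      rw [norm_div, norm_neg, div_lt_one (by linarith)]
      linarith
    have hqζ : q + ζ ≠ 0 := by
      intro h
      have : q = -ζ := eq_neg_of_add_eq_zero_left h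
      rw [this, norm_neg] at hq1
      linarith
    have g1 := (hasSum_coe_mul_geometric_of_norm_lt_one hx).mul_left (α : ℂ)
    have g2 := (hasSum_geometric_of_norm_lt_one hx).mul_left (β : ℂ)
    have g3 := (g1.add g2).mul_left (Complex.exp (vline y) * vline y ^ (-((β + 1 : ℝ) : ℂ)))
    have g4 : HasSum (fun n => F n y) (mlKernel α β ζ y) := by
      convert! g3 using 1
      · funext n
        have e1 : vline y ^ (-((α * n + β + 1 : ℝ) : ℂ))
            = vline y ^ (-((β + 1 : ℝ) : ℂ)) / q ^ n := by
          rw [hq, ← Complex.cpow_nat_mul, ← Complex.cpow_sub _ _ (vline_ne_zero y)]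
          congr 1
          push_cast
          ring
        simp only [hF]
        rw [e1, div_pow]
        field_simp
      · rw [mlKernel, mlQuot, ← hq]
        congr 1
        have : 1 - -ζ / q = (q + ζ) / q := by field_simp; ring
        rw [this]
        field_simp
        ring
    exact g4.tsum_eq
  simp_rw [h1, h2] at key
  exact (hasSum_mittagLefflerC hα hβ (-ζ)).unique key

lemma differentiableOn_integral_mlKernel (hα : 0 < α) (hα1 : α ≤ 1) (hβ : 0 < β) :
    DifferentiableOn ℂ (fun ζ => ∫ y, mlKernel α β ζ y) {ζ | 0 < ζ.re} := by
  intro ζ₀ hζ₀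
  have hζ₀ : 0 < ζ₀.re := hζ₀
  -- The ball of radius `Re ζ₀ / 2` stays away from the imaginary axis and inside one sector, so the
  -- bounds on the quotient are uniform on it.
  set ε := ζ₀.re / 2 with hε
  have hε0 : 0 < ε := by positivity
  set K := (‖ζ₀‖ + ε) / ε with hKdef
  have hball : ∀ ζ ∈ Metric.ball ζ₀ ε, ε < ζ.re ∧ ‖ζ‖ ≤ K * ζ.re := by
    intro ζ hζ
    have h1 : ‖ζ - ζ₀‖ < ε := by simpa [dist_eq_norm] using hζ
    have h2 := (Complex.abs_re_le_norm (ζ - ζ₀)).trans_lt h1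
    rw [Complex.sub_re, abs_lt] at h2
    have h3 : ε < ζ.re := by linarith
    refine ⟨h3, ?_⟩
    have h4 : ‖ζ‖ ≤ ‖ζ₀‖ + ε := by
      have := norm_add_le ζ₀ (ζ - ζ₀)
      rw [add_sub_cancel] at this
      linarith
    calc ‖ζ‖ ≤ ‖ζ₀‖ + ε := h4
      _ = K * ε := by rw [hKdef]; field_simp
      _ ≤ K * ζ.re := by gcongr
  have hK0 : 0 ≤ K := by positivity
  set F' : ℂ → ℝ → ℂ := fun ζ y => Complex.exp (vline y) * vline y ^ (-((β + 1 : ℝ) : ℂ)) *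
    (((β - α) + 2 * α * mlQuot α ζ y) * (-mlQuot α ζ y / (vline y ^ (α : ℂ) + ζ))) with hF'
  have key := hasDerivAt_integral_of_dominated_loc_of_deriv_le (μ := volume)
    (F := fun ζ y => mlKernel α β ζ y) (F' := F') (x₀ := ζ₀) (s := Metric.ball ζ₀ ε)
    (bound := fun y => Real.exp 1 * ‖vline y‖ ^ (-(β + 1)) *
      ((|β - α| + 2 * α * (1 + K)) * ((1 + K) / ε)))
    (Metric.ball_mem_nhds _ hε0) ?_ (integrable_mlKernel hα.le hα1 hβ hζ₀) ?_ ?_ ?_ ?_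
  · exact key.2.differentiableAt.differentiableWithinAt
  · filter_upwards [Metric.ball_mem_nhds ζ₀ hε0] with ζ hζ
    exact (continuous_mlKernel hα.le hα1 (hε0.trans (hball ζ hζ).1)).aestronglyMeasurable
  · refine Continuous.aestronglyMeasurable ?_
    have h1 := continuous_mlQuot hα.le hα1 hζ₀
    have h2 := continuous_vline_cpow (-((β + 1 : ℝ) : ℂ))
    have h3 : Continuous fun y => -mlQuot α ζ₀ y / (vline y ^ (α : ℂ) + ζ₀) :=
      h1.neg.div ((continuous_vline_cpow _).add continuous_const)
        (vline_cpow_add_ne_zero hα.le hα1 hζ₀)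
    simp only [hF']
    fun_prop
  · refine Eventually.of_forall fun y ζ hζ => ?_
    obtain ⟨h1, h2⟩ := hball ζ hζ
    have h0 : 0 < ζ.re := hε0.trans h1
    have hθ := norm_mlQuot_le hα.le hα1 h0 y h2
    have hden := h1.le.trans (re_le_norm_vline_cpow_add hα.le hα1 ζ y)
    simp only [hF']
    rw [norm_mul, norm_exp_mul_vline_cpow, norm_mul, norm_div, norm_neg]
    gcongr
    refine (norm_add_le _ _).trans ?_
    rw [← Complex.ofReal_sub, Complex.norm_real, Real.norm_eq_abs, norm_mul, norm_mul,
      Complex.norm_real, Real.norm_of_nonneg hα.le, Complex.norm_ofNat]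
    gcongr
  · exact ((integrable_norm_vline_rpow (a := β + 1) (by linarith)).const_mul _).mul_const _
  · refine Eventually.of_forall fun y ζ hζ => ?_
    have hne := vline_cpow_add_ne_zero hα.le hα1 (hε0.trans (hball ζ hζ).1) y
    have hq : HasDerivAt (fun ζ => mlQuot α ζ y)
        (-mlQuot α ζ y / (vline y ^ (α : ℂ) + ζ)) ζ := by
      have h := (hasDerivAt_const ζ (vline y ^ (α : ℂ))).div
        ((hasDerivAt_id ζ).const_add (vline y ^ (α : ℂ))) hne
      refine h.congr_deriv ?_
      simp only [mlQuot, id]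
      field_simp
      ring
    have h := ((hq.const_mul ((β : ℂ) - α)).add ((hq.pow 2).const_mul (α : ℂ))).const_mul
      (Complex.exp (vline y) * vline y ^ (-((β + 1 : ℝ) : ℂ)))
    refine h.congr_deriv ?_
    simp only [hF']
    push_cast
    ring

/-- The integral representation of `E_{α,β}(-ζ)` in the right half-plane, for `0 < α ≤ 1`. -/
theorem mittagLefflerC_neg_eq_integral (hα : 0 < α) (hα1 : α ≤ 1) (hβ : 0 < β) {ζ : ℂ}
    (hζ : 0 < ζ.re) : mittagLefflerC α β (-ζ) = ∫ y, mlKernel α β ζ y := by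
  have hopen : IsOpen {p : ℂ | 0 < p.re} := isOpen_lt continuous_const Complex.continuous_re
  have hd : Differentiable ℂ fun ζ => mittagLefflerC α β (-ζ) :=
    (differentiable_mittagLefflerC hα hβ).comp differentiable_neg
  refine (hd.differentiableOn.analyticOnNhd hopen).eqOn_of_preconnected_of_eventuallyEq
    ((differentiableOn_integral_mlKernel hα hα1 hβ).analyticOnNhd hopen)
    -- The point `1/2` is interior both to the half-plane and to the unit disc, where the geometric
    -- expansion is valid.
    (convex_halfSpace_re_gt 0).isPreconnected (z₀ := 1 / 2) (by simp) ?_ hζ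
  have : ∀ᶠ ζ in 𝓝 (1 / 2 : ℂ), ‖ζ‖ < 1 :=
    (isOpen_lt continuous_norm continuous_const).mem_nhds (by
      change ‖(1 / 2 : ℂ)‖ < 1
      norm_num)
  filter_upwards [this] with ζ h
  exact mittagLefflerC_neg_eq_integral_of_norm_lt hα hβ h

/-- `E_{α,β}(-ζ)` is bounded on every sector `‖ζ‖ ≤ K Re ζ`. -/
theorem exists_norm_mittagLefflerC_neg_le (hα : 0 < α) (hα1 : α ≤ 1) (hβ : 0 < β) {K : ℝ}
    (hK0 : 0 ≤ K) :
    ∃ C, 0 ≤ C ∧ ∀ ζ : ℂ, ‖ζ‖ ≤ K * ζ.re → ‖mittagLefflerC α β (-ζ)‖ ≤ C := by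
  set C := (∫ y, Real.exp 1 * ‖vline y‖ ^ (-(β + 1))) *
    ((|β - α| + α * (1 + K)) * (1 + K)) with hC
  have hC0 : 0 ≤ C := by
    have : 0 ≤ ∫ y, Real.exp 1 * ‖vline y‖ ^ (-(β + 1)) :=
      integral_nonneg fun y => by positivity
    positivity
  -- The sector contains its vertex `ζ = 0`, where the integral representation is not available.
  refine ⟨max C ‖mittagLefflerC α β 0‖, le_max_of_le_left hC0, fun ζ hζ => ?_⟩
  by_cases h0 : ζ = 0
  · rw [h0, neg_zero]
    exact le_max_right _ _
  have hre : 0 < ζ.re := by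
    have : 0 < ‖ζ‖ := norm_pos_iff.2 h0
    by_contra h
    nlinarith
  refine le_trans ?_ (le_max_left _ _)
  rw [mittagLefflerC_neg_eq_integral hα hα1 hβ hre, hC, ← integral_mul_const]
  refine norm_integral_le_of_norm_le (((integrable_norm_vline_rpow (a := β + 1)
    (by linarith)).const_mul _).mul_const _) (Eventually.of_forall fun y => ?_)
  refine (norm_mlKernel_le hα.le hα1 hre y hζ).trans ?_
  have hθ := norm_mlQuot_le hα.le hα1 hre y hζ
  gcongr

/-- `E_{α,β}(-ζ) = O(‖ζ‖ ^ (-1/2))` on every sector `‖ζ‖ ≤ K Re ζ`. -/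
theorem exists_norm_mittagLefflerC_neg_mul_sqrt_le (hα : 0 < α) (hα1 : α ≤ 1) (hβ : α / 2 < β)
    {K : ℝ} (hK0 : 0 ≤ K) :
    ∃ C, 0 ≤ C ∧ ∀ ζ : ℂ, ‖ζ‖ ≤ K * ζ.re → ‖mittagLefflerC α β (-ζ)‖ * √‖ζ‖ ≤ C := by
  set C := (∫ y, Real.exp 1 * ‖vline y‖ ^ (-(β + 1 - α / 2))) *
    ((|β - α| + α * (1 + K)) * √(K * (1 + K))) with hC
  have hC0 : 0 ≤ C := by
    have : 0 ≤ ∫ y, Real.exp 1 * ‖vline y‖ ^ (-(β + 1 - α / 2)) :=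
      integral_nonneg fun y => by positivity
    positivity
  refine ⟨C, hC0, fun ζ hζ => ?_⟩
  by_cases h0 : ζ = 0
  · simpa [h0] using hC0
  have hre : 0 < ζ.re := by
    have : 0 < ‖ζ‖ := norm_pos_iff.2 h0
    by_contra h
    nlinarith
  have hn : ‖mittagLefflerC α β (-ζ)‖ * √‖ζ‖ = ‖∫ y, mlKernel α β ζ y * (√‖ζ‖ : ℂ)‖ := by
    rw [integral_mul_const, norm_mul, mittagLefflerC_neg_eq_integral hα hα1 (by linarith) hre,
      Complex.norm_real, Real.norm_of_nonneg (Real.sqrt_nonneg _)]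
  rw [hn, hC, ← integral_mul_const]
  refine norm_integral_le_of_norm_le (((integrable_norm_vline_rpow (a := β + 1 - α / 2)
    (by linarith)).const_mul _).mul_const _) (Eventually.of_forall fun y => ?_)
  have h1 := norm_mlKernel_le (β := β) hα.le hα1 hre y hζ
  have h2 := norm_mlQuot_mul_sqrt_le hα.le hα1 hre y hζ
  have hv : 0 < ‖vline y‖ := norm_pos_iff.2 (vline_ne_zero y)
  rw [norm_mul, Complex.norm_real, Real.norm_of_nonneg (Real.sqrt_nonneg _)]
  calc ‖mlKernel α β ζ y‖ * √‖ζ‖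
      ≤ (Real.exp 1 * ‖vline y‖ ^ (-(β + 1)) *
        ((|β - α| + α * (1 + K)) * ‖mlQuot α ζ y‖)) * √‖ζ‖ := by gcongr
    _ = Real.exp 1 * ‖vline y‖ ^ (-(β + 1)) * (|β - α| + α * (1 + K)) *
        (‖mlQuot α ζ y‖ * √‖ζ‖) := by ring
    _ ≤ Real.exp 1 * ‖vline y‖ ^ (-(β + 1)) * (|β - α| + α * (1 + K)) *
        (√(K * (1 + K)) * ‖vline y‖ ^ (α / 2)) := by gcongr
    _ = Real.exp 1 * (‖vline y‖ ^ (-(β + 1)) * ‖vline y‖ ^ (α / 2)) *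
        ((|β - α| + α * (1 + K)) * √(K * (1 + K))) := by ring
    _ = _ := by
        rw [← Real.rpow_add hv]
        ring_nf

/-- A bound for `E_{α,β}` on the negative half-line. -/
theorem exists_abs_mittagLeffler_neg_le (hα : 0 < α) (hα1 : α ≤ 1) (hβ : 0 < β) :
    ∃ C, 0 ≤ C ∧ ∀ x : ℝ, 0 ≤ x → |mittagLeffler α β (-x)| ≤ C := by
  obtain ⟨C, hC, h⟩ := exists_norm_mittagLefflerC_neg_le hα hα1 hβ zero_le_one
  refine ⟨C, hC, fun x hx => ?_⟩
  have h1 := h (x : ℂ) (by simp [abs_of_nonneg hx])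
  rwa [← Complex.ofReal_neg, mittagLefflerC_ofReal, Complex.norm_real, Real.norm_eq_abs] at h1

/-- The decay of `E_{α,β}` on the negative half-line. -/
theorem exists_abs_mittagLeffler_neg_mul_sqrt_le (hα : 0 < α) (hα1 : α ≤ 1) (hβ : α / 2 < β) :
    ∃ C, 0 ≤ C ∧ ∀ x : ℝ, 0 ≤ x → |mittagLeffler α β (-x)| * √x ≤ C := by
  obtain ⟨C, hC, h⟩ := exists_norm_mittagLefflerC_neg_mul_sqrt_le hα hα1 hβ zero_le_one
  refine ⟨C, hC, fun x hx => ?_⟩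
  have h1 := h (x : ℂ) (by simp [abs_of_nonneg hx])
  rwa [← Complex.ofReal_neg, mittagLefflerC_ofReal, Complex.norm_real, Complex.norm_real,
    Real.norm_eq_abs, Real.norm_of_nonneg hx] at h1

end

section

/-! ### Right fractional integrals -/

section Vector

variable {X Y : Type*} [NormedAddCommGroup X] [NormedSpace ℝ X]
  [NormedAddCommGroup Y] [NormedSpace ℝ Y] {α T t : ℝ}

lemma rightRL_zero (T : ℝ) (f : ℝ → X) (t : ℝ) : rightRL 0 T f t = f t := if_pos rfl

lemma rightRL_of_ne (hα : α ≠ 0) (T : ℝ) (f : ℝ → X) (t : ℝ) :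
    rightRL α T f t = (Real.Gamma α)⁻¹ • ∫ τ in t..T, (τ - t) ^ (α - 1) • f τ := if_neg hα

lemma rightRLExists_iff (hα : α ≠ 0) (ht : t ≤ T) {f : ℝ → X} :
    RightRLExists α T f t ↔
      IntervalIntegrable (fun τ => (τ - t) ^ (α - 1) • f τ) volume t T := by
  rw [intervalIntegrable_iff_integrableOn_Ioo_of_le ht]
  exact ⟨fun h => h hα, fun h _ => h⟩

lemma rightRL_congr (ht : t < T) {f g : ℝ → X} (h : EqOn f g (Ico t T)) :
    rightRL α T f t = rightRL α T g t := by
  by_cases hα : α = 0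
  · subst hα
    rw [rightRL_zero, rightRL_zero, h ⟨le_rfl, ht⟩]
  · rw [rightRL_of_ne hα, rightRL_of_ne hα]
    congr 1
    rw [intervalIntegral.integral_of_le ht.le, intervalIntegral.integral_of_le ht.le,
      integral_Ioc_eq_integral_Ioo, integral_Ioc_eq_integral_Ioo]
    refine setIntegral_congr_fun measurableSet_Ioo fun τ hτ => ?_
    simp only [h ⟨hτ.1.le, hτ.2⟩]

lemma rightRL_congr_ae (hα : α ≠ 0) (ht : t ≤ T) {f g : ℝ → X}
    (h : ∀ᵐ τ ∂(volume.restrict (Ioo t T)), f τ = g τ) :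
    rightRL α T f t = rightRL α T g t := by
  rw [rightRL_of_ne hα, rightRL_of_ne hα]
  congr 1
  rw [intervalIntegral.integral_of_le ht, intervalIntegral.integral_of_le ht,
    integral_Ioc_eq_integral_Ioo, integral_Ioc_eq_integral_Ioo]
  refine integral_congr_ae ?_
  filter_upwards [h] with τ hτ
  rw [hτ]

lemma RightRLExists.clm_comp {f : ℝ → X} (h : RightRLExists α T f t) (L : X →L[ℝ] Y) :
    RightRLExists α T (fun τ => L (f τ)) t := by
  intro hα
  refine (L.integrable_comp (h hα)).congr (Eventually.of_forall fun τ => ?_)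
  simp

lemma rightRL_clm_comp [CompleteSpace X] [CompleteSpace Y] {f : ℝ → X} (ht : t ≤ T)
    (h : RightRLExists α T f t) (L : X →L[ℝ] Y) :
    rightRL α T (fun τ => L (f τ)) t = L (rightRL α T f t) := by
  by_cases hα : α = 0
  · subst hα
    simp [rightRL_zero]
  · rw [rightRL_of_ne hα, rightRL_of_ne hα, map_smul,
      ← L.intervalIntegral_comp_comm ((rightRLExists_iff hα ht).1 h)]
    simp only [map_smul]

lemma rightRL_sub {f g : ℝ → X} (ht : t ≤ T) (hf : RightRLExists α T f t)
    (hg : RightRLExists α T g t) :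
    rightRL α T (fun τ => f τ - g τ) t = rightRL α T f t - rightRL α T g t := by
  by_cases hα : α = 0
  · subst hα
    simp [rightRL_zero]
  · rw [rightRL_of_ne hα, rightRL_of_ne hα, rightRL_of_ne hα, ← smul_sub,
      ← intervalIntegral.integral_sub ((rightRLExists_iff hα ht).1 hf)
        ((rightRLExists_iff hα ht).1 hg)]
    simp only [smul_sub]

lemma rightRL_const_mul (c : ℝ) (f : ℝ → ℝ) :
    rightRL α T (fun τ => c * f τ) t = c * rightRL α T f t := by
  by_cases hα : α = 0
  · subst hα
    simp [rightRL_zero]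
  · rw [rightRL_of_ne hα, rightRL_of_ne hα, smul_eq_mul, smul_eq_mul, mul_left_comm]
    congr 1
    rw [← intervalIntegral.integral_const_mul]
    congr 1
    funext τ
    simp only [smul_eq_mul]
    ring

lemma RightRLExists.const_mul {f : ℝ → ℝ} (h : RightRLExists α T f t) (c : ℝ) :
    RightRLExists α T (fun τ => c * f τ) t := by
  intro hα
  refine ((h hα).const_mul c).congr (Eventually.of_forall fun τ => ?_)
  simp only [smul_eq_mul]
  ring

lemma rightRL_one (T : ℝ) (f : ℝ → X) (t : ℝ) : rightRL 1 T f t = ∫ τ in t..T, f τ := by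
  simp [rightRL_of_ne one_ne_zero]

end Vector

variable {α β T t : ℝ}

/-! ### The beta integral -/

lemma integral_beta_right (hα : 0 < α) (hβ : 0 < β) (ht : t < T) :
    ∫ τ in t..T, (τ - t) ^ (α - 1) * (T - τ) ^ (β - 1)
      = (T - t) ^ (α + β - 1) * (Real.Gamma α * Real.Gamma β / Real.Gamma (α + β)) := by
  have hs : 0 < T - t := sub_pos.2 ht
  have h1 := Complex.betaIntegral_scaled (α : ℂ) (β : ℂ) hs
  have h2 := Complex.Gamma_mul_Gamma_eq_betaIntegral (s := (α : ℂ)) (t := (β : ℂ))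
    (by simpa using hα) (by simpa using hβ)
  have hG : Complex.Gamma ((α : ℂ) + β) ≠ 0 := by
    apply Complex.Gamma_ne_zero_of_re_pos
    simpa using add_pos hα hβ
  have h3 : Complex.betaIntegral (α : ℂ) (β : ℂ)
      = ((Real.Gamma α * Real.Gamma β / Real.Gamma (α + β) : ℝ) : ℂ) := by
    push_cast
    rw [← Complex.Gamma_ofReal, ← Complex.Gamma_ofReal, ← Complex.Gamma_ofReal, h2]
    push_cast
    field_simp
  rw [h3] at h1
  have h4 : ∫ τ in t..T, (τ - t) ^ (α - 1) * (T - τ) ^ (β - 1)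
      = ∫ x in (0 : ℝ)..(T - t), x ^ (α - 1) * ((T - t) - x) ^ (β - 1) := by
    have h := intervalIntegral.integral_comp_sub_right
      (fun x => x ^ (α - 1) * ((T - t) - x) ^ (β - 1)) t (a := t) (b := T)
    rw [sub_self] at h
    rw [← h]
    congr 1
    funext τ
    ring_nf
  rw [h4]
  apply Complex.ofReal_injective
  rw [← intervalIntegral.integral_ofReal]
  push_cast at h1 ⊢
  rw [Complex.ofReal_cpow hs.le]
  push_cast
  rw [← h1]
  refine intervalIntegral.integral_congr fun x hx => ?_
  rw [uIcc_of_le hs.le] at hx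
  have h5 : 0 ≤ T - t - x := by linarith [hx.2]
  rw [Complex.ofReal_cpow hx.1, Complex.ofReal_cpow h5]
  push_cast
  rfl

/-- A function that is not integrable has integral `0` by convention, while the beta integral is
positive. -/
lemma intervalIntegrable_beta_right (hα : 0 < α) (hβ : 0 < β) (ht : t < T) :
    IntervalIntegrable (fun τ => (τ - t) ^ (α - 1) * (T - τ) ^ (β - 1)) volume t T := by
  refine intervalIntegral.intervalIntegrable_of_integral_ne_zero ?_
  rw [integral_beta_right hα hβ ht]
  have hs : 0 < T - t := sub_pos.2 ht
  have h1 := Real.Gamma_pos_of_pos hα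
  have h2 := Real.Gamma_pos_of_pos hβ
  have h3 := Real.Gamma_pos_of_pos (add_pos hα hβ)
  positivity

lemma intervalIntegrable_sub_rpow (hα : 0 < α) (t a b : ℝ) :
    IntervalIntegrable (fun τ => (τ - t) ^ (α - 1)) volume a b := by
  have h : IntervalIntegrable (fun x : ℝ => x ^ (α - 1)) volume (a - t) (b - t) :=
    intervalIntegral.intervalIntegrable_rpow' (by linarith)
  simpa using h.comp_sub_right t

end

section

variable {α β μ T t lam : ℝ}

/-! ### Fractional integrals of Mittag-Leffler functions -/

/-- The function `s ↦ s ^ (β - 1) E_{μ,β}(-lam s ^ μ)`. -/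
def mlFun (μ β lam s : ℝ) : ℝ := s ^ (β - 1) * mittagLeffler μ β (-lam * s ^ μ)

lemma continuous_mittagLeffler_rpow (hμ : 0 < μ) (hβ : 0 < β) (lam : ℝ) :
    Continuous (fun s : ℝ => mittagLeffler μ β (-lam * s ^ μ)) :=
  (continuous_mittagLeffler hμ hβ).comp
    (continuous_const.mul (Real.continuous_rpow_const hμ.le))

lemma continuousOn_mlFun (hμ : 0 < μ) (hβ : 0 < β) (lam : ℝ) :
    ContinuousOn (mlFun μ β lam) (Ioi 0) := by
  refine ContinuousOn.mul ?_ (continuous_mittagLeffler_rpow hμ hβ lam).continuousOn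
  exact fun s hs => (Real.continuousAt_rpow_const _ _ (Or.inl (ne_of_gt hs))).continuousWithinAt

lemma rightRLExists_mlFun (hα : 0 ≤ α) (hβ : 0 < β) (hμ : 0 < μ) (ht : t < T) :
    RightRLExists α T (fun τ => mlFun μ β lam (T - τ)) t := by
  by_cases hα0 : α = 0
  · exact fun h => absurd hα0 h
  have hα : 0 < α := lt_of_le_of_ne hα (Ne.symm hα0)
  rw [rightRLExists_iff hα0 ht.le]
  have h := (intervalIntegrable_beta_right hα hβ ht).mul_continuousOn
    (((continuous_mittagLeffler_rpow hμ hβ lam).comp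
      (by fun_prop : Continuous fun τ : ℝ => T - τ)).continuousOn)
  refine h.congr fun τ _ => ?_
  simp only [Function.comp, mlFun, smul_eq_mul]
  ring

/-- Term by term, the beta integral maps `(T-τ)^(μn+β-1) / Γ(μn+β)` to the same expression with `α +
β` in place of `β`. -/
lemma rightRL_mlFun (hα : 0 ≤ α) (hβ : 0 < β) (hμ : 0 < μ) (ht : t < T) :
    rightRL α T (fun τ => mlFun μ β lam (T - τ)) t = mlFun μ (α + β) lam (T - t) := by
  by_cases hα0 : α = 0
  · subst hα0
    rw [rightRL_zero, zero_add]
  have hα : 0 < α := lt_of_le_of_ne hα (Ne.symm hα0)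
  have hs : 0 < T - t := sub_pos.2 ht
  have hGα := Real.Gamma_pos_of_pos hα
  set F : ℕ → ℝ → ℝ := fun n τ => ((-lam) ^ n / Real.Gamma (μ * n + β)) *
    ((τ - t) ^ (α - 1) * (T - τ) ^ (μ * n + β - 1)) with hF
  have hβn : ∀ n : ℕ, 0 < μ * n + β := fun n => by positivity
  have hFi : ∀ n, Integrable (F n) (volume.restrict (Ioo t T)) := fun n =>
    ((intervalIntegrable_iff_integrableOn_Ioo_of_le ht.le).1
      (intervalIntegrable_beta_right hα (hβn n) ht)).const_mul _
  have hval : ∀ n : ℕ, ∫ τ in Ioo t T, (τ - t) ^ (α - 1) * (T - τ) ^ (μ * n + β - 1)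
      = (T - t) ^ (α + β - 1) * ((T - t) ^ μ) ^ n *
        (Real.Gamma α * Real.Gamma (μ * n + β) / Real.Gamma (μ * n + (α + β))) := by
    intro n
    rw [← integral_Ioc_eq_integral_Ioo, ← intervalIntegral.integral_of_le ht.le,
      integral_beta_right hα (hβn n) ht, ← Real.rpow_natCast, ← Real.rpow_mul hs.le,
      ← Real.rpow_add hs]
    ring_nf
  have hint : ∀ n : ℕ, ∫ τ in Ioo t T, F n τ = (T - t) ^ (α + β - 1) * Real.Gamma α *
      ((-lam * (T - t) ^ μ) ^ n / Real.Gamma (μ * n + (α + β))) := by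
    intro n
    have := mittagLeffler_Gamma_pos hμ hβ n
    have := mittagLeffler_Gamma_pos hμ (add_pos hα hβ) n
    simp only [hF]
    rw [integral_const_mul, hval, mul_pow]
    field_simp
  -- The integrals of the absolute values form, up to a constant, the convergent Mittag-Leffler
  -- series at `|lam| (T-t)^μ`.
  have key := hasSum_integral_of_summable_integral_norm hFi (by
    have h := (summable_mittagLeffler_norm hμ (add_pos hα hβ)
      (r := |lam| * (T - t) ^ μ) (by positivity)).mul_left ((T - t) ^ (α + β - 1) * Real.Gamma α)
    refine h.congr fun n => ?_
    have h1 := mittagLeffler_Gamma_pos hμ hβ n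
    have h2 := mittagLeffler_Gamma_pos hμ (add_pos hα hβ) n
    have h3 : ∫ τ in Ioo t T, ‖F n τ‖ = ∫ τ in Ioo t T, (|lam| ^ n / Real.Gamma (μ * n + β)) *
        ((τ - t) ^ (α - 1) * (T - τ) ^ (μ * n + β - 1)) := by
      refine setIntegral_congr_fun measurableSet_Ioo fun τ hτ => ?_
      have h4 : 0 < τ - t := sub_pos.2 hτ.1
      have h5 : 0 < T - τ := sub_pos.2 hτ.2
      simp only [hF]
      rw [norm_mul, norm_div, norm_pow, norm_neg, Real.norm_eq_abs, Real.norm_of_nonneg h1.le,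
        Real.norm_of_nonneg (by positivity)]
    rw [h3, integral_const_mul, hval, mul_pow]
    field_simp)
  have hpt : ∀ τ ∈ Ioo t T, ∑' n, F n τ = (τ - t) ^ (α - 1) • mlFun μ β lam (T - τ) := by
    intro τ hτ
    have h5 : 0 < T - τ := sub_pos.2 hτ.2
    have h := (hasSum_mittagLeffler hμ hβ (-lam * (T - τ) ^ μ)).mul_left
      ((τ - t) ^ (α - 1) * (T - τ) ^ (β - 1))
    refine HasSum.tsum_eq ?_
    rw [mlFun, smul_eq_mul, ← mul_assoc]
    refine h.congr_fun fun n => ?_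
    simp only [hF]
    rw [mul_pow, add_sub_assoc, Real.rpow_add h5, Real.rpow_mul h5.le, Real.rpow_natCast]
    ring
  rw [rightRL_of_ne hα0, intervalIntegral.integral_of_le ht.le, integral_Ioc_eq_integral_Ioo,
    ← setIntegral_congr_fun measurableSet_Ioo hpt, ← key.tsum_eq]
  simp_rw [hint]
  rw [tsum_mul_left, (hasSum_mittagLeffler hμ (add_pos hα hβ) _).tsum_eq, mlFun, smul_eq_mul]
  field_simp

/-! ### The semigroup property -/

/-- Composition of right fractional integrals of total order at least one. -/
theorem rightRL_rightRL (hα : 0 < α) (hβ : 0 < β) (hαβ : 1 ≤ α + β) (ht : t < T) {f : ℝ → ℝ}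
    (hf : IntervalIntegrable f volume t T) :
    rightRL α T (rightRL β T f) t = rightRL (α + β) T f t := by
  have hGα := Real.Gamma_pos_of_pos hα
  have hGβ := Real.Gamma_pos_of_pos hβ
  have hGs := Real.Gamma_pos_of_pos (add_pos hα hβ)
  rw [intervalIntegrable_iff_integrableOn_Ioo_of_le ht.le] at hf
  set B : ℝ := Real.Gamma α * Real.Gamma β / Real.Gamma (α + β) with hB
  have hB0 : 0 < B := by positivity
  -- The triangle `t < σ < τ < T` is encoded by an indicator so that Fubini applies on a square; the
  -- integral in `σ` is then a beta integral.
  set k : ℝ → ℝ → ℝ := fun σ τ => (σ - t) ^ (α - 1) * (Iio τ).indicator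
    (fun σ => (τ - σ) ^ (β - 1)) σ with hk
  have hk0 : ∀ σ ∈ Ioo t T, ∀ τ, 0 ≤ k σ τ := by
    intro σ hσ τ
    have h1 : 0 < σ - t := sub_pos.2 hσ.1
    simp only [hk]
    refine mul_nonneg (by positivity) (indicator_nonneg (fun σ' h => ?_) _)
    have : 0 < τ - σ' := sub_pos.2 h
    positivity
  have hkeq : ∀ τ, ∀ σ, k σ τ = (Iio τ).indicator
      (fun σ => (σ - t) ^ (α - 1) * (τ - σ) ^ (β - 1)) σ := by
    intro τ σ
    simp only [hk, indicator]
    split_ifs <;> simp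
  have hset : ∀ τ ∈ Ioo t T, Ioo t T ∩ Iio τ = Ioo t τ := by
    intro τ hτ
    ext σ
    simp only [mem_inter_iff, mem_Ioo, mem_Iio]
    exact ⟨fun h => ⟨h.1.1, h.2⟩, fun h => ⟨⟨h.1, h.2.trans hτ.2⟩, h.2⟩⟩
  have hki : ∀ τ ∈ Ioo t T, Integrable (fun σ => k σ τ) (volume.restrict (Ioo t T)) := by
    intro τ hτ
    simp_rw [hkeq τ]
    rw [integrable_indicator_iff measurableSet_Iio, IntegrableOn, Measure.restrict_restrict
      measurableSet_Iio, inter_comm, hset τ hτ]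
    exact (intervalIntegrable_iff_integrableOn_Ioo_of_le hτ.1.le).1
      (intervalIntegrable_beta_right hα hβ hτ.1)
  have hkv : ∀ τ ∈ Ioo t T, ∫ σ in Ioo t T, k σ τ = (τ - t) ^ (α + β - 1) * B := by
    intro τ hτ
    simp_rw [hkeq τ]
    rw [setIntegral_indicator measurableSet_Iio, hset τ hτ, ← integral_Ioc_eq_integral_Ioo,
      ← intervalIntegral.integral_of_le hτ.1.le, integral_beta_right hα hβ hτ.1]
  have hkm : Measurable (Function.uncurry k) := by
    have : Function.uncurry k = fun p : ℝ × ℝ => (p.1 - t) ^ (α - 1) *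
        {p : ℝ × ℝ | p.1 < p.2}.indicator (fun p => (p.2 - p.1) ^ (β - 1)) p := by
      funext p
      simp [hk, Function.uncurry, indicator]
    rw [this]
    refine Measurable.mul (by fun_prop) (Measurable.indicator (by fun_prop) ?_)
    exact measurableSet_lt measurable_fst measurable_snd
  have hmeas : AEStronglyMeasurable (Function.uncurry fun σ τ => k σ τ * f τ)
      ((volume.restrict (Ioo t T)).prod (volume.restrict (Ioo t T))) :=
    hkm.aestronglyMeasurable.mul hf.aestronglyMeasurable.comp_snd
  -- Here the total order must be at least one: the composed kernel is then continuous up to `τ =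
  -- t`, and mere integrability of `f` suffices at every `t`.
  have hweight : ContinuousOn (fun τ : ℝ => (τ - t) ^ (α + β - 1)) (Icc t T) := by
    have : Continuous fun τ : ℝ => (τ - t) ^ (α + β - 1) :=
      (Real.continuous_rpow_const (by linarith)).comp (continuous_id.sub continuous_const)
    exact this.continuousOn
  have hprod : Integrable (Function.uncurry fun σ τ => k σ τ * f τ)
      ((volume.restrict (Ioo t T)).prod (volume.restrict (Ioo t T))) := by
    rw [integrable_prod_iff' hmeas]
    constructor
    · filter_upwards [ae_restrict_mem measurableSet_Ioo] with τ hτ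
      exact (hki τ hτ).mul_const (f τ)
    · have h1 : Integrable (fun τ => (τ - t) ^ (α + β - 1) * B * ‖f τ‖)
          (volume.restrict (Ioo t T)) := by
        have h2 : IntervalIntegrable (fun τ => ‖f τ‖ * ((τ - t) ^ (α + β - 1))) volume t T :=
          ((intervalIntegrable_iff_integrableOn_Ioo_of_le ht.le).2 hf.norm).mul_continuousOn
            (by rwa [uIcc_of_le ht.le])
        refine (((intervalIntegrable_iff_integrableOn_Ioo_of_le ht.le).1 h2).mul_const B).congr
          (Eventually.of_forall fun τ => ?_)
        simp only
        ring
      refine h1.congr ?_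
      filter_upwards [ae_restrict_mem measurableSet_Ioo] with τ hτ
      rw [← hkv τ hτ, ← integral_mul_const]
      refine setIntegral_congr_fun measurableSet_Ioo fun σ hσ => ?_
      simp only [Function.uncurry, norm_mul]
      rw [Real.norm_of_nonneg (hk0 σ hσ τ)]
  have hswap := integral_integral_swap hprod
  have hleft : ∀ σ ∈ Ioo t T, ∫ τ in Ioo t T, k σ τ * f τ
      = Real.Gamma β * ((σ - t) ^ (α - 1) • rightRL β T f σ) := by
    intro σ hσ
    have h1 : ∀ τ, k σ τ * f τ = (σ - t) ^ (α - 1) *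
        (Ioi σ).indicator (fun τ => (τ - σ) ^ (β - 1) • f τ) τ := by
      intro τ
      simp only [hk, indicator, mem_Iio, mem_Ioi, smul_eq_mul]
      split_ifs <;> ring
    have h2 : Ioo t T ∩ Ioi σ = Ioo σ T := by
      ext τ
      simp only [mem_inter_iff, mem_Ioo, mem_Ioi]
      exact ⟨fun h => ⟨h.2, h.1.2⟩, fun h => ⟨⟨hσ.1.trans h.1, h.2⟩, h.1⟩⟩
    simp_rw [h1]
    rw [integral_const_mul, setIntegral_indicator measurableSet_Ioi, h2, rightRL_of_ne hβ.ne',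
      intervalIntegral.integral_of_le hσ.2.le, integral_Ioc_eq_integral_Ioo, smul_eq_mul,
      smul_eq_mul]
    field_simp
  have hright : ∀ τ ∈ Ioo t T, ∫ σ in Ioo t T, k σ τ * f τ
      = B * ((τ - t) ^ (α + β - 1) • f τ) := by
    intro τ hτ
    rw [integral_mul_const, hkv τ hτ, smul_eq_mul]
    ring
  rw [setIntegral_congr_fun measurableSet_Ioo hleft,
    setIntegral_congr_fun measurableSet_Ioo hright, integral_const_mul, integral_const_mul] at hswap
  rw [rightRL_of_ne hα.ne', rightRL_of_ne (add_pos hα hβ).ne',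
    intervalIntegral.integral_of_le ht.le, intervalIntegral.integral_of_le ht.le,
    integral_Ioc_eq_integral_Ioo, integral_Ioc_eq_integral_Ioo, smul_eq_mul, smul_eq_mul]
  have h3 : ∫ σ in Ioo t T, (σ - t) ^ (α - 1) • rightRL β T f σ
      = (Real.Gamma β)⁻¹ * (B * ∫ τ in Ioo t T, (τ - t) ^ (α + β - 1) • f τ) := by
    rw [← hswap]
    field_simp
  rw [h3, hB]
  field_simp

end

section

variable {α β μ T t lam : ℝ}

/-! ### Uniqueness for the scalar equations -/

/-- For `α ≤ 1` the singular kernel can be removed by multiplying with the continuous function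
`(τ-t)^(1-α)`. -/
lemma RightRLExists.intervalIntegrable (hα0 : α ≠ 0) (hα1 : α ≤ 1) (ht : t ≤ T) {f : ℝ → ℝ}
    (h : RightRLExists α T f t) : IntervalIntegrable f volume t T := by
  have h1 := (rightRLExists_iff hα0 ht).1 h
  have h2 : ContinuousOn (fun τ : ℝ => (τ - t) ^ (1 - α)) (uIcc t T) :=
    ((Real.continuous_rpow_const (by linarith)).comp
      (by fun_prop : Continuous fun τ : ℝ => τ - t)).continuousOn
  refine (h1.mul_continuousOn h2).congr fun τ hτ => ?_
  rw [uIoc_of_le ht] at hτ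
  have h3 : 0 < τ - t := sub_pos.2 hτ.1
  have h4 : (τ - t) ^ (α - 1) * (τ - t) ^ (1 - α) = 1 := by
    rw [← Real.rpow_add h3]
    simp
  simp only [smul_eq_mul]
  linear_combination f τ * h4

/-- An integrable function that is continuous at the left endpoint has fractional integrals of
every positive order. -/
lemma rightRLExists_of_continuousOn (hα : 0 < α) (ht : t < T) {f : ℝ → ℝ}
    (hf : ContinuousOn f (Ico t T)) (hfi : IntervalIntegrable f volume t T) :
    RightRLExists α T f t := by
  rw [rightRLExists_iff hα.ne' ht.le]
  set c := (t + T) / 2 with hc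
  have h1 : t < c := by rw [hc]; linarith
  have h2 : c < T := by rw [hc]; linarith
  refine IntervalIntegrable.trans (b := c) ?_ ?_
  · refine (intervalIntegrable_sub_rpow hα t t c).mul_continuousOn (hf.mono ?_)
    rw [uIcc_of_le h1.le]
    exact fun x hx => ⟨hx.1, hx.2.trans_lt h2⟩
  · refine IntervalIntegrable.continuousOn_mul (hfi.mono_set ?_) ?_
    · rw [uIcc_of_le h2.le, uIcc_of_le ht.le]
      exact Icc_subset_Icc h1.le le_rfl
    · intro τ hτ
      rw [uIcc_of_le h2.le] at hτ
      have : τ - t ≠ 0 := by linarith [hτ.1]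
      have h : ContinuousAt (fun τ : ℝ => (τ - t) ^ (α - 1)) τ :=
        ContinuousAt.rpow_const (by fun_prop) (Or.inl this)
      exact h.continuousWithinAt

/-- In the sup norm with weight `exp (k τ)`, the operator `I^μ` has norm at most `k^{-μ}`: enlarging
the interval to a half-line leaves a Gamma integral. -/
lemma abs_rightRL_exp_le (hμ : 0 < μ) (ht : t ≤ T) {k M : ℝ} (hk : 0 < k) {Z : ℝ → ℝ}
    (hZ : ∀ τ ∈ Ioo t T, |Z τ| ≤ M * Real.exp (-(k * τ))) (hM : 0 ≤ M) :
    |rightRL μ T Z t| ≤ (1 / k) ^ μ * (M * Real.exp (-(k * t))) := by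
  have hG := Real.Gamma_pos_of_pos hμ
  have hi : IntegrableOn (fun s : ℝ => s ^ (μ - 1) * Real.exp (-(k * s))) (Ioi 0) := by
    have := integrableOn_rpow_mul_exp_neg_mul_rpow (s := μ - 1) (p := 1) (by linarith) one_pos hk
    simpa using this
  have hmajI : IntervalIntegrable
      (fun τ => (τ - t) ^ (μ - 1) * (M * Real.exp (-(k * τ)))) volume t T :=
    (intervalIntegrable_sub_rpow hμ t t T).mul_continuousOn (by fun_prop)
  have h1 : |∫ τ in t..T, (τ - t) ^ (μ - 1) • Z τ|
      ≤ ∫ τ in t..T, (τ - t) ^ (μ - 1) * (M * Real.exp (-(k * τ))) := by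
    rw [intervalIntegral.integral_of_le ht, intervalIntegral.integral_of_le ht,
      integral_Ioc_eq_integral_Ioo, integral_Ioc_eq_integral_Ioo]
    refine norm_integral_le_of_norm_le (f := fun τ => (τ - t) ^ (μ - 1) • Z τ)
      ((intervalIntegrable_iff_integrableOn_Ioo_of_le ht).1 hmajI) ?_
    filter_upwards [ae_restrict_mem measurableSet_Ioo] with τ hτ
    have h3 : 0 < τ - t := sub_pos.2 hτ.1
    rw [norm_smul, Real.norm_of_nonneg (by positivity)]
    gcongr
    exact hZ τ hτ
  have h2 : ∫ τ in t..T, (τ - t) ^ (μ - 1) * (M * Real.exp (-(k * τ)))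
      ≤ (M * Real.exp (-(k * t))) * ((1 / k) ^ μ * Real.Gamma μ) := by
    have h3 := intervalIntegral.integral_comp_sub_right
      (fun x => x ^ (μ - 1) * (M * Real.exp (-(k * (x + t))))) t (a := t) (b := T)
    simp only [sub_add_cancel, sub_self] at h3
    rw [h3, ← Real.integral_rpow_mul_exp_neg_mul_Ioi hμ hk,
      intervalIntegral.integral_of_le (by linarith), ← integral_const_mul]
    have h4 : ∀ x : ℝ, x ^ (μ - 1) * (M * Real.exp (-(k * (x + t))))
        = M * Real.exp (-(k * t)) * (x ^ (μ - 1) * Real.exp (-(k * x))) := by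
      intro x
      rw [mul_add, neg_add, Real.exp_add]
      ring
    simp_rw [h4]
    refine setIntegral_mono_set (hi.const_mul _) ?_ Ioc_subset_Ioi_self.eventuallyLE
    filter_upwards [ae_restrict_mem measurableSet_Ioi] with x hx
    have hx : 0 < x := hx
    positivity
  rw [rightRL_of_ne hμ.ne', smul_eq_mul, abs_mul, abs_of_pos (inv_pos.2 hG)]
  calc (Real.Gamma μ)⁻¹ * |∫ τ in t..T, (τ - t) ^ (μ - 1) • Z τ|
      ≤ (Real.Gamma μ)⁻¹ * ((M * Real.exp (-(k * t))) * ((1 / k) ^ μ * Real.Gamma μ)) := by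
        gcongr
        exact h1.trans h2
    _ = _ := by field_simp

/-- A bounded solution of the homogeneous Volterra equation `Z = c I^μ Z` vanishes. -/
lemma eq_zero_of_eq_const_mul_rightRL (hμ : 0 < μ) {c : ℝ} {Z : ℝ → ℝ} {M : ℝ}
    (hM : ∀ t ∈ Ioo 0 T, |Z t| ≤ M) (hZ : ∀ t ∈ Ioo 0 T, Z t = c * rightRL μ T Z t) :
    ∀ t ∈ Ioo 0 T, Z t = 0 := by
  intro t₀ ht₀
  have hT : 0 < T := ht₀.1.trans ht₀.2
  have hM0 : 0 ≤ M := (abs_nonneg _).trans (hM t₀ ht₀)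
  obtain ⟨k, hk0, hk⟩ : ∃ k : ℝ, 0 < k ∧ |c| * (1 / k) ^ μ ≤ 1 / 2 := by
    -- With `k^μ = 2|c| + 1` each use of the equation halves the weighted bound.
    refine ⟨(2 * |c| + 1) ^ (1 / μ), by positivity, ?_⟩
    rw [Real.div_rpow zero_le_one (by positivity), Real.one_rpow, ← Real.rpow_mul (by positivity),
      one_div_mul_cancel hμ.ne', Real.rpow_one, mul_one_div, div_le_div_iff₀ (by positivity)
      two_pos]
    linarith
  set M' := M * Real.exp (k * T) with hM'
  have hM'0 : 0 ≤ M' := by positivity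
  have key : ∀ n : ℕ, ∀ t ∈ Ioo 0 T, |Z t| ≤ (M' * (1 / 2) ^ n) * Real.exp (-(k * t)) := by
    intro n
    induction n with
    | zero =>
      intro t ht
      refine (hM t ht).trans ?_
      rw [pow_zero, mul_one, hM', mul_assoc, ← Real.exp_add]
      refine le_mul_of_one_le_right hM0 (Real.one_le_exp ?_)
      nlinarith [ht.2]
    | succ n ih =>
      intro t ht
      have h1 := abs_rightRL_exp_le (T := T) hμ ht.2.le hk0
        (fun τ hτ => ih τ ⟨ht.1.trans hτ.1, hτ.2⟩) (by positivity)
      rw [hZ t ht, abs_mul]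
      calc |c| * |rightRL μ T Z t|
          ≤ |c| * ((1 / k) ^ μ * (M' * (1 / 2) ^ n * Real.exp (-(k * t)))) := by gcongr
        _ = (|c| * (1 / k) ^ μ) * (M' * (1 / 2) ^ n * Real.exp (-(k * t))) := by ring
        _ ≤ 1 / 2 * (M' * (1 / 2) ^ n * Real.exp (-(k * t))) := by gcongr
        _ = _ := by ring
  have hlim : Tendsto (fun n : ℕ => (M' * (1 / 2) ^ n) * Real.exp (-(k * t₀))) atTop (𝓝 0) := by
    have h := ((tendsto_pow_atTop_nhds_zero_of_lt_one (r := (1 / 2 : ℝ)) (by norm_num)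
      (by norm_num)).const_mul M').mul_const (Real.exp (-(k * t₀)))
    simpa using h
  have := ge_of_tendsto' hlim fun n => key n t₀ ht₀
  exact abs_nonpos_iff.1 this

lemma intervalIntegrable_of_continuousOn_of_tendsto {f : ℝ → ℝ} {l : ℝ} (ht : t < T)
    (hf : ContinuousOn f (Ico t T)) (hl : Tendsto f (𝓝[<] T) (𝓝 l)) :
    IntervalIntegrable f volume t T := by
  have hfo := hf.mono Ioo_subset_Ico_self
  have h : ContinuousOn (extendFrom (Ioo t T) f) (Icc t T) := by
    refine continuousOn_Icc_extendFrom_Ioo hfo (la := f t) ?_ hl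
    have h1 := ((hf t ⟨le_rfl, ht⟩).mono Ioo_subset_Ico_self).tendsto
    rwa [nhdsWithin_Ioo_eq_nhdsGT ht] at h1
  have h2 := h.intervalIntegrable_of_Icc (μ := volume) ht.le
  rw [intervalIntegrable_iff_integrableOn_Ioo_of_le ht.le] at h2 ⊢
  exact h2.congr_fun (extendFrom_extends hfo) measurableSet_Ioo

lemma eqOn_zero_of_forall_integral_eq_zero {z : ℝ → ℝ} (hz : ContinuousOn z (Ioo 0 T))
    (hzi : ∀ t ∈ Ioo 0 T, IntervalIntegrable z volume t T)
    (h : ∀ t ∈ Ioo 0 T, ∫ τ in t..T, z τ = 0) : ∀ t ∈ Ioo 0 T, z t = 0 := by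
  intro t ht
  have h1 : HasDerivAt (fun u => ∫ τ in u..T, z τ) (-z t) t :=
    intervalIntegral.integral_hasDerivAt_left (hzi t ht)
      (hz.stronglyMeasurableAtFilter isOpen_Ioo t ht) (hz.continuousAt (isOpen_Ioo.mem_nhds ht))
  have h2 : HasDerivAt (fun u => ∫ τ in u..T, z τ) 0 t := by
    refine (hasDerivAt_const t (0 : ℝ)).congr_of_eventuallyEq ?_
    filter_upwards [isOpen_Ioo.mem_nhds ht] with u hu
    exact h u hu
  have := h1.unique h2
  linarith

/-- The scalar backward equation: if `w = I^b y` has the derivative `γ`, the final value `y₀`, and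
`I^a γ = lam y`, where `a + b = 1 - μ`, then `y` is a multiple of a Mittag-Leffler function. -/
theorem eq_mlFun_of_scalar_equation {a b y₀ : ℝ} {y γ : ℝ → ℝ} (hT : 0 < T) (ha : 0 ≤ a)
    (hb : 0 ≤ b) (hμ : 0 < μ) (hab : a + b = 1 - μ)
    (hyc : ContinuousOn y (Ico 0 T)) (hye : ∀ t ∈ Ico 0 T, RightRLExists b T y t)
    (hfin : Tendsto (rightRL b T y) (𝓝[<] T) (𝓝 y₀))
    (hder : ∀ s t : ℝ, 0 < s → s ≤ t → t < T → IntervalIntegrable γ volume s t ∧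
      rightRL b T y t - rightRL b T y s = ∫ τ in s..t, γ τ)
    (heq : ∀ᵐ t ∂(volume.restrict (Ioo 0 T)),
      RightRLExists a T γ t ∧ lam * y t = rightRL a T γ t) :
    ∀ t ∈ Ico 0 T, y t = y₀ * mlFun μ (1 - b) lam (T - t) := by
  have hb1 : b < 1 := by linarith
  have ha1 : a < 1 := by linarith
  have hyi : ∀ t ∈ Ico 0 T, IntervalIntegrable y volume t T := by
    intro t ht
    -- For `b = 0` the existence hypothesis is empty; integrability near `T` then comes from the
    -- final value.
    by_cases hb0 : b = 0
    · refine intervalIntegrable_of_continuousOn_of_tendsto ht.2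
        (hyc.mono (Ico_subset_Ico ht.1 le_rfl)) (l := y₀) ?_
      refine hfin.congr fun τ => ?_
      rw [hb0, rightRL_zero]
    · exact (hye t ht).intervalIntegrable hb0 hb1.le ht.2.le
  have hγi : ∀ t ∈ Ioo 0 T, IntervalIntegrable γ volume t T := by
    intro t ht
    by_cases ha0 : a = 0
    · have h1 := (intervalIntegrable_iff_integrableOn_Ioo_of_le ht.2.le).1
        (hyi t ⟨ht.1.le, ht.2⟩)
      rw [intervalIntegrable_iff_integrableOn_Ioo_of_le ht.2.le]
      refine (h1.const_mul lam).congr ?_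
      filter_upwards [ae_restrict_of_ae_restrict_of_subset (Ioo_subset_Ioo ht.1.le le_rfl) heq]
        with τ hτ
      rw [hτ.2, ha0, rightRL_zero]
    -- `I^a γ` is known to exist only almost everywhere, so some point to the left of `t` is used.
    · have h1 : ∃ t' ∈ Ioo 0 t, RightRLExists a T γ t' := by
        have h2 := ae_restrict_of_ae_restrict_of_subset
          (Ioo_subset_Ioo le_rfl ht.2.le : Ioo 0 t ⊆ Ioo 0 T) heq
        have h3 : NeBot (ae (volume.restrict (Ioo 0 t))) := by
          rw [ae_neBot, Ne, Measure.restrict_eq_zero, Real.volume_Ioo]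
          simpa using ht.1
        obtain ⟨t', h4, h5⟩ := (h2.and (ae_restrict_mem measurableSet_Ioo)).exists
        exact ⟨t', h5, h4.1⟩
      obtain ⟨t', ht', he⟩ := h1
      refine (he.intervalIntegrable ha0 ha1.le (ht'.2.trans ht.2).le).mono_set ?_
      rw [uIcc_of_le ht.2.le, uIcc_of_le (ht'.2.trans ht.2).le]
      exact Icc_subset_Icc ht'.2.le le_rfl
  have hw : ∀ t ∈ Ioo 0 T, rightRL b T y t = y₀ - ∫ τ in t..T, γ τ := by
    intro t ht
    have h1 : Tendsto (fun t' => ∫ τ in t..t', γ τ) (𝓝[<] T) (𝓝 (∫ τ in t..T, γ τ)) := by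
      have h2 := intervalIntegral.continuousOn_primitive_interval'
        (hγi t ht) (left_mem_uIcc)
      have h3 := (h2 T right_mem_uIcc).tendsto
      rw [uIcc_of_le ht.2.le] at h3
      refine h3.mono_left ?_
      rw [← nhdsWithin_Ioo_eq_nhdsLT ht.2]
      exact nhdsWithin_mono _ Ioo_subset_Icc_self
    have h4 : Tendsto (fun t' => rightRL b T y t' - rightRL b T y t) (𝓝[<] T)
        (𝓝 (y₀ - rightRL b T y t)) := hfin.sub_const _
    have h5 : (fun t' => rightRL b T y t' - rightRL b T y t) =ᶠ[𝓝[<] T]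
        fun t' => ∫ τ in t..t', γ τ := by
      filter_upwards [Ioo_mem_nhdsLT ht.2] with t' ht'
      exact (hder t t' ht.1 ht'.1.le ht'.2).2
    have := tendsto_nhds_unique (h4.congr' h5) h1
    linarith
  have h1a : 0 < 1 - a := by linarith
  have h1b : 0 < 1 - b := by linarith
  -- `lam y` is replaced by `I^a γ` under `I^{1-a}`, and `I^{1-a} I^a γ = I^1 γ`.
  have hvol : ∀ t ∈ Ioo 0 T, rightRL b T y t = y₀ - lam * rightRL (1 - a) T y t := by
    intro t ht
    rw [hw t ht, ← rightRL_const_mul, ← rightRL_one,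
      rightRL_congr_ae h1a.ne' ht.2.le (g := rightRL a T γ)]
    · by_cases ha0 : a = 0
      · have : rightRL a T γ = γ := by
          funext τ
          rw [ha0, rightRL_zero]
        rw [this, ha0, sub_zero]
      · rw [rightRL_rightRL h1a (lt_of_le_of_ne ha (Ne.symm ha0)) (by linarith) ht.2 (hγi t ht),
          sub_add_cancel]
    · filter_upwards [ae_restrict_of_ae_restrict_of_subset (Ioo_subset_Ioo ht.1.le le_rfl) heq]
        with τ hτ
      exact hτ.2
  set κ : ℝ → ℝ := fun τ => y₀ * mlFun μ (1 - b) lam (T - τ) with hκ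
  have hκe : ∀ {c t : ℝ}, 0 ≤ c → t < T → RightRLExists c T κ t := fun hc ht =>
    (rightRLExists_mlFun hc h1b hμ ht).const_mul y₀
  have hκc : ContinuousOn κ (Iio T) := by
    refine continuousOn_const.mul ((continuousOn_mlFun hμ h1b lam).comp (by fun_prop) ?_)
    exact fun τ hτ => mem_Ioi.2 (sub_pos.2 hτ)
  -- The candidate solves the same equation because `E_{μ,1}(x) = 1 + x E_{μ,μ+1}(x)`.
  have hκv : ∀ t ∈ Ioo 0 T, rightRL b T κ t = y₀ - lam * rightRL (1 - a) T κ t := by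
    intro t ht
    have hs : 0 < T - t := sub_pos.2 ht.2
    simp only [hκ]
    rw [rightRL_const_mul, rightRL_const_mul, rightRL_mlFun hb h1b hμ ht.2,
      rightRL_mlFun h1a.le h1b hμ ht.2]
    have e1 : b + (1 - b) = 1 := by ring
    have e2 : 1 - a + (1 - b) = μ + 1 := by linarith
    rw [e1, e2, mlFun, mlFun, mittagLeffler_eq_add hμ one_pos, add_sub_cancel_right, sub_self,
      Real.rpow_zero, Real.Gamma_one]
    ring
  set z : ℝ → ℝ := fun τ => y τ - κ τ with hz
  have hzc : ContinuousOn z (Ico 0 T) := hyc.sub (hκc.mono fun τ hτ => hτ.2)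
  have hzi : ∀ t ∈ Ico 0 T, IntervalIntegrable z volume t T := fun t ht =>
    (hyi t ht).sub ((hκe zero_le_one ht.2).intervalIntegrable one_ne_zero le_rfl ht.2.le)
  have hzv : ∀ t ∈ Ioo 0 T, rightRL b T z t = -lam * rightRL (1 - a) T z t := by
    intro t ht
    have ht' : t ∈ Ico 0 T := ⟨ht.1.le, ht.2⟩
    have hc := hyc.mono (Ico_subset_Ico ht.1.le le_rfl)
    simp only [hz]
    rw [rightRL_sub ht.2.le (hye t ht') (hκe hb ht.2),
      rightRL_sub ht.2.le (rightRLExists_of_continuousOn h1a ht.2 hc (hyi t ht'))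
        (hκe h1a.le ht.2), hvol t ht, hκv t ht]
    ring
  -- `I^{1-b}` is applied to the equation of `z`; the orders add up to `(1-b) + (1-a) = μ + 1`.
  -- Passing to `I^1 z` matters: `z` may be unbounded near `T`, but its primitive is bounded by its
  -- `L¹` norm.
  have hZ : ∀ t ∈ Ioo 0 T, rightRL 1 T z t = -lam * rightRL μ T (rightRL 1 T z) t := by
    intro t ht
    have hti := hzi t ⟨ht.1.le, ht.2⟩
    have h1 : rightRL (1 - b) T (rightRL b T z) t = rightRL 1 T z t := by
      by_cases hb0 : b = 0
      · have : rightRL b T z = z := by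
          funext τ
          rw [hb0, rightRL_zero]
        rw [this, hb0, sub_zero]
      · rw [rightRL_rightRL h1b (lt_of_le_of_ne hb (Ne.symm hb0)) (by linarith) ht.2 hti,
          sub_add_cancel]
    rw [← h1, rightRL_congr ht.2 (g := fun τ => -lam * rightRL (1 - a) T z τ)
      (fun τ hτ => hzv τ ⟨ht.1.trans_le hτ.1, hτ.2⟩), rightRL_const_mul,
      rightRL_rightRL h1b h1a (by linarith) ht.2 hti,
      rightRL_rightRL hμ one_pos (by linarith) ht.2 hti]
    congr 2
    linarith
  have hZ0 := eq_zero_of_eq_const_mul_rightRL (T := T) hμ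
    (M := ∫ τ in Ioc 0 T, |z τ|) (Z := rightRL 1 T z) (fun t ht => by
      have hi := (intervalIntegrable_iff_integrableOn_Ioc_of_le hT.le).1 (hzi 0 ⟨le_rfl, hT⟩)
      rw [rightRL_one, intervalIntegral.integral_of_le ht.2.le]
      refine (norm_integral_le_integral_norm (f := z) (μ := volume.restrict (Ioc t T))).trans ?_
      exact setIntegral_mono_set hi.norm (Eventually.of_forall fun τ => norm_nonneg _)
        (Ioc_subset_Ioc ht.1.le le_rfl).eventuallyLE) hZ
  have hz0 := eqOn_zero_of_forall_integral_eq_zero (hzc.mono Ioo_subset_Ico_self)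
    (fun t ht => hzi t ⟨ht.1.le, ht.2⟩) (fun t ht => by rw [← rightRL_one]; exact hZ0 t ht)
  -- The equation holds on the open interval only; the value at `0` follows by continuity.
  have hfinal : EqOn z (fun _ => 0) (Ico 0 T) := by
    refine EqOn.of_subset_closure (s := Ioo 0 T) hz0 hzc continuousOn_const Ioo_subset_Ico_self ?_
    rw [closure_Ioo hT.ne]
    exact Ico_subset_Icc_self
  intro t ht
  have := hfinal ht
  simp only [hz, hκ] at this
  linarith

end

section

variable {H : Type u} [NormedAddCommGroup H] [InnerProductSpace ℝ H] [CompleteSpace H]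
  {A : H →ₗ.[ℝ] H}

/-! ### The spectral decomposition of the operator -/

/-- The resolvent `(1 + A)⁻¹`. -/
def resolventOne (hA : IsAdmissible A) : H →L[ℝ] H :=
  incl hA ∘L ContinuousLinearMap.adjoint (incl hA)

lemma inner_ofDomain (hA : IsAdmissible A) (x : FormDomain hA) (y : A.domain) :
    inner ℝ x (ofDomain hA y) = inner ℝ (incl hA x) (y : H) + inner ℝ (incl hA x) (A y) := by
  have h := form_ofDomain_right hA x y
  rw [form, incl_ofDomain] at h
  linarith

/-- The adjoint of `incl` sends `x` to the Riesz representative of `(x, ·)` in the form inner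
product, that is, to the weak solution of `u + A u = x`. Testing with `D(A)` puts `u` in the domain
of the adjoint of `A`, which is `A`. -/
lemma resolventOne_spec (hA : IsAdmissible A) (x : H) :
    ∃ h : resolventOne hA x ∈ A.domain,
      A ⟨resolventOne hA x, h⟩ = x - resolventOne hA x := by
  have hd := hA.selfAdjoint.dense_domain
  have hB := LinearPMap.isSelfAdjoint_def.1 hA.selfAdjoint
  have key : ∀ z : A.domain, inner ℝ (x - resolventOne hA x) (z : H)
      = inner ℝ (resolventOne hA x) (A z) := by
    intro z
    have h1 := inner_ofDomain hA (ContinuousLinearMap.adjoint (incl hA) x) z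
    rw [ContinuousLinearMap.adjoint_inner_left, incl_ofDomain] at h1
    rw [inner_sub_left, h1]
    change _ + _ - inner ℝ (incl hA (ContinuousLinearMap.adjoint (incl hA) x)) _ = _
    rw [add_sub_cancel_left]
    rfl
  have hmem : resolventOne hA x ∈ A.adjoint.domain :=
    LinearPMap.mem_adjoint_domain_of_exists _ ⟨_, key⟩
  have hval : A.adjoint ⟨_, hmem⟩ = x - resolventOne hA x :=
    LinearPMap.adjoint_apply_eq hd ⟨_, hmem⟩ key
  -- The membership proof depends on the operator, so the equality of `A` with its adjoint is
  -- eliminated for a variable `B`.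
  have transport : ∀ B : H →ₗ.[ℝ] H, B = A → ∀ (h : resolventOne hA x ∈ B.domain),
      B ⟨_, h⟩ = x - resolventOne hA x → ∃ h : resolventOne hA x ∈ A.domain,
        A ⟨resolventOne hA x, h⟩ = x - resolventOne hA x := by
    rintro B rfl h h'
    exact ⟨h, h'⟩
  exact transport _ hB hmem hval

lemma resolventOne_isSymmetric (hA : IsAdmissible A) :
    (resolventOne hA : H →ₗ[ℝ] H).IsSymmetric := by
  intro x y
  exact (ContinuousLinearMap.adjoint_inner_right (incl hA)
    (ContinuousLinearMap.adjoint (incl hA) x) y).symm.trans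
      (ContinuousLinearMap.adjoint_inner_left (incl hA)
        (ContinuousLinearMap.adjoint (incl hA) y) x)

/-- The resolvent factors through the graph as `x ↦ (R x, x - R x)`, followed by the compact
projection. -/
lemma isCompactOperator_resolventOne (hA : IsAdmissible A) :
    IsCompactOperator (resolventOne hA) := by
  have hmem : ∀ x : H, (resolventOne hA x, x - resolventOne hA x) ∈ A.graph := by
    intro x
    obtain ⟨h, h'⟩ := resolventOne_spec hA x
    rw [LinearPMap.mem_graph_iff]
    exact ⟨⟨_, h⟩, rfl, h'⟩
  set G : H →L[ℝ] A.graph :=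
    ((resolventOne hA).prod (ContinuousLinearMap.id ℝ H - resolventOne hA)).codRestrict A.graph hmem
    with hG
  exact hA.compact.comp_clm G

/-- There is an orthonormal basis of eigenvectors of the operator. -/
theorem exists_hilbertBasis_eigenvectors (hA : IsAdmissible A) :
    ∃ (ι : Type u) (lam : ι → ℝ) (φ : HilbertBasis ι ℝ H),
      ∀ i, ∃ h : φ i ∈ A.domain, A ⟨φ i, h⟩ = lam i • φ i := by
  set R := resolventOne hA with hR
  have hcomp := isCompactOperator_resolventOne hA
  have hsymm := resolventOne_isSymmetric hA
  have hcompl : ∀ c : ℝ, CompleteSpace (Module.End.eigenspace (R : H →ₗ[ℝ] H) c) := by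
    intro c
    have : (Module.End.eigenspace (R : H →ₗ[ℝ] H) c : Set H)
        = (LinearMap.ker (R - c • ContinuousLinearMap.id ℝ H).toLinearMap : Set H) := by
      ext x
      simp [sub_eq_zero]
    refine IsClosed.completeSpace_coe (hs := ?_)
    rw [this]
    exact (R - c • ContinuousLinearMap.id ℝ H).isClosed_ker
  have hex : ∀ c : ℝ, ∃ (w : Set (Module.End.eigenspace (R : H →ₗ[ℝ] H) c))
      (b : HilbertBasis w ℝ (Module.End.eigenspace (R : H →ₗ[ℝ] H) c)),
      ⇑b = ((↑) : w → (Module.End.eigenspace (R : H →ₗ[ℝ] H) c)) :=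
    fun c => exists_hilbertBasis ℝ _
  choose w b _ using hex
  have hon : Orthonormal ℝ (fun a : Σ c : ℝ, w c => ((b a.1 a.2 : _) : H)) :=
    hsymm.orthogonalFamily_eigenspaces.orthonormal_sigma_orthonormal fun c => (b c).orthonormal
  -- A vector orthogonal to the bases of all eigenspaces is orthogonal to the eigenspaces, whose
  -- joint orthogonal complement is trivial by the spectral theorem.
  have hspan : (Submodule.span ℝ (range fun a : Σ c : ℝ, w c => ((b a.1 a.2 : _) : H)))ᗮ = ⊥ := by
    rw [eq_bot_iff, ← ContinuousLinearMap.orthogonalComplement_iSup_eigenspaces_eq_bot hcomp hsymm,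
      ← Submodule.iInf_orthogonal]
    intro x hx
    rw [Submodule.mem_iInf]
    intro c
    rw [Submodule.mem_orthogonal]
    intro y hy
    have h1 := (b c).hasSum_repr ⟨y, hy⟩
    have h2 := (h1.mapL (Module.End.eigenspace (R : H →ₗ[ℝ] H) c).subtypeL).mapL
      (innerSL ℝ x)
    rw [real_inner_comm]
    refine h2.unique (hasSum_zero.congr_fun fun i => ?_)
    have h3 : inner ℝ x ((b c i : _) : H) = 0 :=
      (Submodule.mem_orthogonal' _ _).1 hx _ (Submodule.subset_span ⟨⟨c, i⟩, rfl⟩)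
    rw [map_smul, map_smul, Submodule.subtypeL_apply, innerSL_apply_apply, h3, smul_zero]
  refine ⟨_, fun a => a.1⁻¹ - 1, HilbertBasis.mkOfOrthogonalEqBot hon hspan, ?_⟩
  rintro ⟨c, i⟩
  rw [HilbertBasis.coe_mkOfOrthogonalEqBot]
  simp only
  have hx : R ((b c i : _) : H) = c • ((b c i : _) : H) :=
    Module.End.mem_eigenspace_iff.1 (b c i).2
  set x : H := ((b c i : _) : H) with hxdef
  have hx0 : x ≠ 0 := hon.ne_zero ⟨c, i⟩
  obtain ⟨h, h'⟩ := resolventOne_spec hA x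
  -- If `R x = 0`, then `x = x - R x = A 0 = 0`.
  have hc : c ≠ 0 := by
    rintro rfl
    rw [zero_smul] at hx
    have : (⟨resolventOne hA x, h⟩ : A.domain) = 0 := Subtype.ext hx
    rw [this, LinearPMap.map_zero, ← hR, hx, sub_zero] at h'
    exact hx0 h'.symm
  have hxe : x = c⁻¹ • R x := by
    rw [hx, smul_smul, inv_mul_cancel₀ hc, one_smul]
  have hmem : x ∈ A.domain := by
    rw [hxe]
    exact A.domain.smul_mem _ h
  refine ⟨hmem, ?_⟩
  have h3 : (⟨x, hmem⟩ : A.domain) = c⁻¹ • ⟨resolventOne hA x, h⟩ := Subtype.ext hxe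
  rw [h3, LinearPMap.map_smul, h', smul_sub, ← hR, ← hxe, sub_smul, one_smul]

/-! ### The eigenbasis in the form domain -/

variable {ι : Type u} {lam : ι → ℝ} {φ : HilbertBasis ι ℝ H}

lemma eigenvalue_pos_of_basis (hA : IsAdmissible A)
    (hφ : ∀ i, ∃ h : φ i ∈ A.domain, A ⟨φ i, h⟩ = lam i • φ i) (i : ι) : 0 < lam i := by
  obtain ⟨h, h'⟩ := hφ i
  exact hA.eigenvalue_pos (lam i) ⟨φ i, h⟩ (φ.orthonormal.ne_zero i) h'

/-- An orthonormal basis of eigenvectors gives, after scaling, an orthonormal basis of the form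
domain. -/
theorem exists_formBasis (hA : IsAdmissible A)
    (hφ : ∀ i, ∃ h : φ i ∈ A.domain, A ⟨φ i, h⟩ = lam i • φ i) :
    ∃ e : HilbertBasis ι ℝ (FormDomain hA),
      (∀ i, incl hA (e i) = (√(1 + lam i))⁻¹ • φ i) ∧
      ∀ i x, inner ℝ x (e i) = √(1 + lam i) * inner ℝ (incl hA x) (φ i) := by
  have hpos : ∀ i, 0 < √(1 + lam i) := fun i =>
    Real.sqrt_pos.2 (by linarith [eigenvalue_pos_of_basis hA hφ i])
  -- The form norm of a unit eigenvector is `√(1 + lam)`.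
  set v : ι → FormDomain hA := fun i =>
    (√(1 + lam i))⁻¹ • ofDomain hA ⟨φ i, (hφ i).choose⟩ with hv
  have hincl : ∀ i, incl hA (v i) = (√(1 + lam i))⁻¹ • φ i := by
    intro i
    simp only [hv]
    rw [map_smul, incl_ofDomain]
  have hinner : ∀ i x, inner ℝ x (v i) = √(1 + lam i) * inner ℝ (incl hA x) (φ i) := by
    intro i x
    have hs : √(1 + lam i) * √(1 + lam i) = 1 + lam i :=
      Real.mul_self_sqrt (by linarith [eigenvalue_pos_of_basis hA hφ i])
    have hne := (hpos i).ne'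
    simp only [hv]
    rw [real_inner_smul_right, inner_ofDomain, (hφ i).choose_spec, real_inner_smul_right]
    field_simp
    linear_combination -(inner ℝ (incl hA x) (φ i)) * hs
  have hon : Orthonormal ℝ v := by
    classical
    rw [orthonormal_iff_ite]
    intro i j
    have hij := orthonormal_iff_ite.1 φ.orthonormal i j
    rw [hinner, hincl, real_inner_smul_left, hij]
    split_ifs with h
    · subst h
      rw [mul_one, mul_inv_cancel₀ (hpos i).ne']
    · simp
  have hspan : (Submodule.span ℝ (range v))ᗮ = ⊥ := by
    rw [eq_bot_iff]
    intro x hx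
    have h1 : ∀ i, inner ℝ (φ i) (incl hA x) = 0 := by
      intro i
      have h2 := (Submodule.mem_orthogonal' _ _).1 hx (v i) (Submodule.subset_span ⟨i, rfl⟩)
      rw [hinner] at h2
      rw [real_inner_comm]
      exact (mul_eq_zero.1 h2).resolve_left (hpos i).ne'
    have h3 : incl hA x = 0 := by
      have h4 := φ.hasSum_repr (incl hA x)
      simp_rw [φ.repr_apply_apply, h1, zero_smul] at h4
      exact h4.unique hasSum_zero
    -- Totality passes from `H` to the form domain through closability of the form.
    exact incl_injective hA (h3.trans (map_zero _).symm)
  refine ⟨HilbertBasis.mkOfOrthogonalEqBot hon hspan, ?_, ?_⟩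
  · rw [HilbertBasis.coe_mkOfOrthogonalEqBot]
    exact hincl
  · rw [HilbertBasis.coe_mkOfOrthogonalEqBot]
    exact hinner

end

section

/-! ### Orthogonal series with bounded multipliers -/

section Multiplier

variable {𝕜 X Y ι : Type*} [RCLike 𝕜] [NormedAddCommGroup X] [InnerProductSpace 𝕜 X]
  {e : ι → X} {c : ι → 𝕜} {f : ι → Y → 𝕜} {M : ℝ}

lemma norm_sum_smul_sq_of_orthonormal (he : Orthonormal 𝕜 e) (a : ι → 𝕜) (s : Finset ι) :
    ‖∑ i ∈ s, a i • e i‖ ^ 2 = ∑ i ∈ s, ‖a i‖ ^ 2 := by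
  have h := he.inner_sum a a s
  have h2 := inner_self_eq_norm_sq_to_K (𝕜 := 𝕜) (∑ i ∈ s, a i • e i)
  rw [h] at h2
  have h3 : ∑ i ∈ s, (starRingEnd 𝕜) (a i) * a i = ((∑ i ∈ s, ‖a i‖ ^ 2 : ℝ) : 𝕜) := by
    push_cast
    exact Finset.sum_congr rfl fun i _ => RCLike.conj_mul _
  rw [h3] at h2
  exact_mod_cast h2.symm

lemma norm_sum_mul_smul_sq_le (he : Orthonormal 𝕜 e) {y : Y} (hf : ∀ i, ‖f i y‖ ≤ M)
    (s : Finset ι) : ‖∑ i ∈ s, (c i * f i y) • e i‖ ^ 2 ≤ M ^ 2 * ∑ i ∈ s, ‖c i‖ ^ 2 := by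
  rw [norm_sum_smul_sq_of_orthonormal he, Finset.mul_sum]
  refine Finset.sum_le_sum fun i _ => ?_
  rw [norm_mul, mul_pow, mul_comm]
  gcongr
  exact hf i

lemma exists_local_bound [TopologicalSpace Y] {S : Set Y} {g : Y → ℝ} (hg : ContinuousOn g S)
    (hf : ∀ y ∈ S, ∀ i, ‖f i y‖ ≤ g y) :
    ∀ y₀ ∈ S, ∃ M, ∃ K ∈ 𝓝[S] y₀, ∀ y ∈ K, ∀ i, ‖f i y‖ ≤ M := by
  intro y₀ hy₀
  have h1 : ∀ᶠ y in 𝓝[S] y₀, g y < g y₀ + 1 := (hg y₀ hy₀).eventually_lt_const (by linarith)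
  refine ⟨g y₀ + 1, _, h1.and self_mem_nhdsWithin, fun y hy i => ?_⟩
  exact (hf y hy.2 i).trans (le_of_lt hy.1)

variable [CompleteSpace X]

lemma summable_multiplier (he : Orthonormal 𝕜 e) (hc : Summable fun i => ‖c i‖ ^ 2) {y : Y}
    (hf : ∀ i, ‖f i y‖ ≤ M) : Summable fun i => (c i * f i y) • e i := by
  rw [summable_iff_vanishing_norm]
  intro ε hε
  obtain ⟨s, hs⟩ := summable_iff_vanishing_norm.1 (hc.mul_left (M ^ 2)) (ε ^ 2) (by positivity)
  refine ⟨s, fun t ht => ?_⟩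
  have h1 := norm_sum_mul_smul_sq_le (c := c) he hf t
  have h2 := hs t ht
  rw [← Finset.mul_sum, Real.norm_eq_abs] at h2
  refine lt_of_pow_lt_pow_left₀ 2 hε.le (h1.trans_lt ((le_abs_self _).trans_lt h2))

/-- The tail bound sees `y` only through `M`. This gives uniform convergence wherever the
multipliers are uniformly bounded, and with it continuity and analyticity of the sums. -/
lemma norm_tsum_sub_sum_multiplier_sq_le (he : Orthonormal 𝕜 e)
    (hc : Summable fun i => ‖c i‖ ^ 2) {y : Y} (hf : ∀ i, ‖f i y‖ ≤ M) (s : Finset ι) :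
    ‖(∑' i, (c i * f i y) • e i) - ∑ i ∈ s, (c i * f i y) • e i‖ ^ 2
      ≤ M ^ 2 * ((∑' i, ‖c i‖ ^ 2) - ∑ i ∈ s, ‖c i‖ ^ 2) := by
  classical
  have h1 : Tendsto (fun t : Finset ι =>
      ‖(∑ i ∈ t, (c i * f i y) • e i) - ∑ i ∈ s, (c i * f i y) • e i‖ ^ 2) atTop
      (𝓝 (‖(∑' i, (c i * f i y) • e i) - ∑ i ∈ s, (c i * f i y) • e i‖ ^ 2)) := by
    have := (summable_multiplier he hc hf).hasSum
    exact ((this.sub_const _).norm).pow 2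
  refine le_of_tendsto h1 ?_
  filter_upwards [eventually_ge_atTop s] with t ht
  rw [← Finset.sum_sdiff ht, add_sub_cancel_right]
  refine (norm_sum_mul_smul_sq_le he hf _).trans ?_
  gcongr
  have h2 := hc.sum_le_tsum t fun i _ => by positivity
  rw [← Finset.sum_sdiff ht] at h2
  linarith

lemma norm_tsum_multiplier_le (he : Orthonormal 𝕜 e) (hc : Summable fun i => ‖c i‖ ^ 2) {y : Y}
    (hM : 0 ≤ M) (hf : ∀ i, ‖f i y‖ ≤ M) :
    ‖∑' i, (c i * f i y) • e i‖ ≤ M * √(∑' i, ‖c i‖ ^ 2) := by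
  have h := norm_tsum_sub_sum_multiplier_sq_le he hc hf ∅
  simp only [Finset.sum_empty, sub_zero] at h
  refine le_of_sq_le_sq ?_ (by positivity)
  rwa [mul_pow, Real.sq_sqrt (tsum_nonneg fun i => by positivity)]

lemma tendstoUniformlyOn_multiplier (he : Orthonormal 𝕜 e) (hc : Summable fun i => ‖c i‖ ^ 2)
    {K : Set Y} (hf : ∀ y ∈ K, ∀ i, ‖f i y‖ ≤ M) :
    TendstoUniformlyOn (fun (s : Finset ι) y => ∑ i ∈ s, (c i * f i y) • e i)
      (fun y => ∑' i, (c i * f i y) • e i) atTop K := by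
  rw [Metric.tendstoUniformlyOn_iff]
  intro ε hε
  have h1 : Tendsto (fun s : Finset ι => M ^ 2 * ((∑' i, ‖c i‖ ^ 2) - ∑ i ∈ s, ‖c i‖ ^ 2)) atTop
      (𝓝 0) := by
    have h : Tendsto (fun s : Finset ι => ∑ i ∈ s, ‖c i‖ ^ 2) atTop (𝓝 (∑' i, ‖c i‖ ^ 2)) :=
      hc.hasSum
    have h2 := (h.const_sub (∑' i, ‖c i‖ ^ 2)).const_mul (M ^ 2)
    rwa [sub_self, mul_zero] at h2
  filter_upwards [h1.eventually_lt_const (show (0 : ℝ) < ε ^ 2 by positivity)] with s hs y hy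
  rw [dist_eq_norm]
  exact lt_of_pow_lt_pow_left₀ 2 hε.le
    ((norm_tsum_sub_sum_multiplier_sq_le he hc (hf y hy) s).trans_lt hs)

lemma tendstoLocallyUniformlyOn_multiplier [TopologicalSpace Y] (he : Orthonormal 𝕜 e)
    (hc : Summable fun i => ‖c i‖ ^ 2) {S : Set Y}
    (hf : ∀ y₀ ∈ S, ∃ M, ∃ K ∈ 𝓝[S] y₀, ∀ y ∈ K, ∀ i, ‖f i y‖ ≤ M) :
    TendstoLocallyUniformlyOn (fun (s : Finset ι) y => ∑ i ∈ s, (c i * f i y) • e i)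
      (fun y => ∑' i, (c i * f i y) • e i) atTop S := by
  intro u hu y₀ hy₀
  obtain ⟨M, K, hK, hM⟩ := hf y₀ hy₀
  exact ⟨K, hK, tendstoUniformlyOn_multiplier he hc hM u hu⟩

lemma continuousOn_tsum_multiplier [TopologicalSpace Y] (he : Orthonormal 𝕜 e)
    (hc : Summable fun i => ‖c i‖ ^ 2) {S : Set Y} (hfc : ∀ i, ContinuousOn (f i) S)
    (hf : ∀ y₀ ∈ S, ∃ M, ∃ K ∈ 𝓝[S] y₀, ∀ y ∈ K, ∀ i, ‖f i y‖ ≤ M) :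
    ContinuousOn (fun y => ∑' i, (c i * f i y) • e i) S := by
  refine (tendstoLocallyUniformlyOn_multiplier he hc hf).continuousOn (Eventually.frequently ?_)
  refine Eventually.of_forall fun s => ?_
  exact continuousOn_finsetSum s fun i _ => (continuousOn_const.mul (hfc i)).smul continuousOn_const

end Multiplier

lemma differentiableOn_tsum_multiplier {X ι : Type*} [NormedAddCommGroup X]
    [InnerProductSpace ℂ X] [CompleteSpace X] {e : ι → X} {c : ι → ℂ} {f : ι → ℂ → ℂ}
    (he : Orthonormal ℂ e) (hc : Summable fun i => ‖c i‖ ^ 2) {S : Set ℂ} (hS : IsOpen S)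
    (hfd : ∀ i, DifferentiableOn ℂ (f i) S)
    (hf : ∀ y₀ ∈ S, ∃ M, ∃ K ∈ 𝓝[S] y₀, ∀ y ∈ K, ∀ i, ‖f i y‖ ≤ M) :
    DifferentiableOn ℂ (fun y => ∑' i, (c i * f i y) • e i) S := by
  refine (tendstoLocallyUniformlyOn_multiplier he hc hf).differentiableOn
    (Eventually.of_forall fun s => ?_) hS
  exact DifferentiableOn.fun_sum fun i _ =>
    ((differentiableOn_const _).mul (hfd i)).smul (differentiableOn_const _)

/-! ### Coefficients with respect to an orthonormal basis -/

lemma summable_norm_inner_sq {ι H : Type*} [NormedAddCommGroup H] [InnerProductSpace ℝ H]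
    (φ : HilbertBasis ι ℝ H) (v : H) : Summable fun i => ‖inner ℝ v (φ i)‖ ^ 2 := by
  refine (φ.summable_inner_mul_inner v v).congr fun i => ?_
  rw [real_inner_comm v, Real.norm_eq_abs, sq_abs, sq]

lemma hilbertBasis_ext {ι H : Type*} [NormedAddCommGroup H] [InnerProductSpace ℝ H]
    (φ : HilbertBasis ι ℝ H) {x y : H} (h : ∀ i, inner ℝ x (φ i) = inner ℝ y (φ i)) : x = y := by
  have h1 := φ.hasSum_repr x
  have h2 := φ.hasSum_repr y
  simp_rw [φ.repr_apply_apply, real_inner_comm] at h1 h2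
  simp_rw [h] at h1
  exact h1.unique h2

lemma inner_tsum_smul {ι H : Type*} [NormedAddCommGroup H] [InnerProductSpace ℝ H]
    {φ : ι → H} (hφ : Orthonormal ℝ φ) {a : ι → ℝ} (ha : Summable fun i => a i • φ i) (i : ι) :
    inner ℝ (∑' j, a j • φ j) (φ i) = a i := by
  classical
  have h1 := ha.hasSum.mapL (innerSL ℝ (φ i))
  have h2 : HasSum (fun j => innerSL ℝ (φ i) (a j • φ j)) (a i) := by
    have h3 : ∀ j, innerSL ℝ (φ i) (a j • φ j) = if j = i then a i else 0 := by
      intro j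
      rw [innerSL_apply_apply, real_inner_smul_right, orthonormal_iff_ite.1 hφ]
      by_cases h : i = j
      · rw [if_pos h, if_pos h.symm, mul_one, h]
      · rw [if_neg h, if_neg (Ne.symm h), mul_zero]
    simp_rw [h3]
    exact hasSum_ite_eq i (a i)
  rw [real_inner_comm]
  exact h1.unique h2

end

section

/-! ### Uniform bounds for the scalar solutions -/

section Bounds

variable {α β μ lam s t T : ℝ}

lemma exists_abs_mlFun_le (hμ : 0 < μ) (hμ1 : μ ≤ 1) (hβ : 0 < β) :
    ∃ C, 0 ≤ C ∧ ∀ lam s : ℝ, 0 ≤ lam → 0 ≤ s → |mlFun μ β lam s| ≤ C * s ^ (β - 1) := by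
  obtain ⟨C, hC, h⟩ := exists_abs_mittagLeffler_neg_le hμ hμ1 hβ
  refine ⟨C, hC, fun lam s hlam hs => ?_⟩
  have h1 := h (lam * s ^ μ) (by positivity)
  rw [mlFun, abs_mul, abs_of_nonneg (by positivity), mul_comm, neg_mul]
  gcongr

/-- Half a power of `lam`, the gap between `H` and `V_{1/2}`, is traded for the singularity
`s^{-μ/2}`. -/
lemma exists_sqrt_mul_abs_mlFun_le (hμ : 0 < μ) (hμ1 : μ ≤ 1) (hβ : μ / 2 < β) :
    ∃ C, 0 ≤ C ∧ ∀ lam s : ℝ, 0 ≤ lam → 0 < s →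
      √lam * |mlFun μ β lam s| ≤ C * s ^ (β - μ / 2 - 1) := by
  obtain ⟨C, hC, h⟩ := exists_abs_mittagLeffler_neg_mul_sqrt_le hμ hμ1 hβ
  refine ⟨C, hC, fun lam s hlam hs => ?_⟩
  have h1 := h (lam * s ^ μ) (by positivity)
  have h2 : √(lam * s ^ μ) = √lam * s ^ (μ / 2) := by
    rw [Real.sqrt_mul hlam, Real.sqrt_eq_rpow (s ^ μ), ← Real.rpow_mul hs.le]
    ring_nf
  have h3 : s ^ (β - 1) = s ^ (β - μ / 2 - 1) * s ^ (μ / 2) := by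
    rw [← Real.rpow_add hs]
    ring_nf
  rw [h2] at h1
  rw [mlFun, abs_mul, abs_of_nonneg (by positivity), h3, neg_mul]
  calc √lam * (s ^ (β - μ / 2 - 1) * s ^ (μ / 2) * |mittagLeffler μ β (-(lam * s ^ μ))|)
      = (|mittagLeffler μ β (-(lam * s ^ μ))| * (√lam * s ^ (μ / 2))) * s ^ (β - μ / 2 - 1) := by
        ring
    _ ≤ _ := by gcongr

lemma mlFun_one_eq (hμ : 0 < μ) (lam s : ℝ) :
    mlFun μ 1 lam s = 1 - lam * mlFun μ (1 + μ) lam s := by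
  rw [mlFun, mlFun, mittagLeffler_eq_add hμ one_pos, sub_self, Real.rpow_zero, Real.Gamma_one,
    add_sub_cancel_left, add_comm μ 1]
  ring

lemma mlFun_one_zero (hμ : 0 < μ) : mlFun μ 1 lam 0 = 1 := by
  rw [mlFun, sub_self, Real.rpow_zero, Real.zero_rpow hμ.ne', mul_zero,
    mittagLeffler_zero_right hμ one_pos, Real.Gamma_one, one_mul, inv_one]

lemma continuous_mlFun_one (hμ : 0 < μ) (lam : ℝ) : Continuous (mlFun μ 1 lam) := by
  refine (continuous_mittagLeffler_rpow hμ one_pos lam).congr fun s => ?_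
  rw [mlFun, sub_self, Real.rpow_zero, one_mul]

/-- This is the derivative of `E_{μ,1}(-lam (T-t)^μ)` in integrated form, obtained from `I^1`
instead of differentiating the series. -/
lemma mlFun_one_sub (hμ : 0 < μ) (hst : s ≤ t) (htT : t < T) :
    mlFun μ 1 lam (T - t) - mlFun μ 1 lam (T - s)
      = lam * ∫ τ in s..t, mlFun μ μ lam (T - τ) := by
  have key : ∀ r, r < T → IntervalIntegrable (fun τ => mlFun μ μ lam (T - τ)) volume r T ∧
      ∫ τ in r..T, mlFun μ μ lam (T - τ) = mlFun μ (1 + μ) lam (T - r) := by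
    intro r hr
    refine ⟨(rightRLExists_mlFun zero_le_one hμ hμ hr).intervalIntegrable one_ne_zero le_rfl hr.le,
      ?_⟩
    rw [← rightRL_one, rightRL_mlFun zero_le_one hμ hμ hr]
  obtain ⟨hs1, hs2⟩ := key s (hst.trans_lt htT)
  obtain ⟨ht1, ht2⟩ := key t htT
  have h := intervalIntegral.integral_interval_sub_interval_comm hs1 ht1
    (hs1.trans ht1.symm)
  rw [intervalIntegral.integral_same, sub_zero, hs2, ht2] at h
  rw [← h, mlFun_one_eq hμ, mlFun_one_eq hμ]
  ring

/-- A continuous function that is `O((T - τ) ^ (β - 1))` has right fractional integrals. -/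
lemma rightRLExists_of_norm_le {X : Type*} [NormedAddCommGroup X] [NormedSpace ℝ X] {f : ℝ → X}
    {C : ℝ} (hα : 0 ≤ α) (hβ : 0 < β) (ht : t < T) (hf : ContinuousOn f (Ioo t T))
    (hC : ∀ τ ∈ Ioo t T, ‖f τ‖ ≤ C * (T - τ) ^ (β - 1)) : RightRLExists α T f t := by
  intro hα0
  have hα : 0 < α := lt_of_le_of_ne hα (Ne.symm hα0)
  have h := (intervalIntegrable_iff_integrableOn_Ioo_of_le ht.le).1
    (intervalIntegrable_beta_right hα hβ ht)
  refine (h.const_mul C).mono' (ContinuousOn.aestronglyMeasurable ?_ measurableSet_Ioo) ?_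
  · refine ContinuousOn.smul (fun τ hτ => ?_) hf
    have h1 : τ - t ≠ 0 := (sub_pos.2 hτ.1).ne'
    have h2 : ContinuousAt (fun τ : ℝ => (τ - t) ^ (α - 1)) τ :=
      ContinuousAt.rpow_const (by fun_prop) (Or.inl h1)
    exact h2.continuousWithinAt
  · filter_upwards [ae_restrict_mem measurableSet_Ioo] with τ hτ
    have h1 : 0 < τ - t := sub_pos.2 hτ.1
    rw [norm_smul, Real.norm_of_nonneg (by positivity)]
    calc (τ - t) ^ (α - 1) * ‖f τ‖ ≤ (τ - t) ^ (α - 1) * (C * (T - τ) ^ (β - 1)) := by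
          gcongr
          exact hC τ hτ
      _ = _ := by ring

lemma continuousOn_sub_rpow (T p : ℝ) : ContinuousOn (fun t : ℝ => (T - t) ^ p) (Iio T) := by
  intro t ht
  have h : ContinuousAt (fun t : ℝ => (T - t) ^ p) t :=
    ContinuousAt.rpow_const (by fun_prop) (Or.inl (sub_pos.2 ht).ne')
  exact h.continuousWithinAt

lemma continuousOn_mlFun_sub (hμ : 0 < μ) (hβ : 0 < β) (lam T : ℝ) :
    ContinuousOn (fun t => mlFun μ β lam (T - t)) (Iio T) :=
  (continuousOn_mlFun hμ hβ lam).comp (by fun_prop) fun _ ht => mem_Ioi.2 (sub_pos.2 ht)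

lemma intervalIntegrable_clm_comp {X Y : Type*} [NormedAddCommGroup X] [NormedSpace ℝ X]
    [NormedAddCommGroup Y] [NormedSpace ℝ Y] (L : X →L[ℝ] Y) {f : ℝ → X}
    (hf : IntervalIntegrable f volume s t) :
    IntervalIntegrable (fun τ => L (f τ)) volume s t :=
  ⟨L.integrable_comp hf.1, L.integrable_comp hf.2⟩

lemma intervalIntegral_clm_comp {X Y : Type*} [NormedAddCommGroup X] [NormedSpace ℝ X]
    [NormedAddCommGroup Y] [NormedSpace ℝ Y] [CompleteSpace X] [CompleteSpace Y] (L : X →L[ℝ] Y)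
    {f : ℝ → X} (hf : IntervalIntegrable f volume s t) :
    ∫ τ in s..t, L (f τ) = L (∫ τ in s..t, f τ) :=
  L.intervalIntegral_comp_comm hf

end Bounds

/-! ### Every weak solution is given by the series -/

variable {H : Type u} [NormedAddCommGroup H] [InnerProductSpace ℝ H] [CompleteSpace H]
  {A : H →ₗ.[ℝ] H} {μ ν T : ℝ} {v₀ : H}

/-- The coefficient of a weak solution with respect to an eigenvector. -/
theorem IsWeakSolution.inner_eigenvector {hA : IsAdmissible A} {v : ℝ → FormDomain hA}
    (hv : IsWeakSolution hA μ ν T v₀ v) (hT : 0 < T) (hν0 : 0 ≤ ν) (hν1 : ν ≤ 1) (hμ0 : 0 < μ)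
    (hμ1 : μ ≤ 1) {x : A.domain} {lam : ℝ} (hx : A x = lam • (x : H)) :
    ∀ t ∈ Ico 0 T, inner ℝ (incl hA (v t)) (x : H)
      = inner ℝ v₀ (x : H) * mlFun μ (1 - ν * (1 - μ)) lam (T - t) := by
  obtain ⟨D, ⟨hDe, g, hg, hDg⟩, -, hDeq⟩ := hv.equation
  -- Evaluation at the eigenvector is a continuous functional on the dual, so it commutes with all
  -- the integrals and yields the scalar equation.
  obtain ⟨L, hL⟩ : ∃ L : FormDual hA →L[ℝ] ℝ, ∀ F, L F = F (ofDomain hA x) :=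
    ⟨ContinuousLinearMap.apply ℝ ℝ (ofDomain hA x), fun _ => rfl⟩
  have hLp : ∀ h : H, L (pivot hA h) = inner ℝ h (x : H) := by
    intro h
    rw [hL, pivot_apply, incl_ofDomain]
  have hb : (1 - (1 - ν)) * (1 - μ) = ν * (1 - μ) := by ring
  rw [hb] at hDe hg
  have hy : (fun τ => inner ℝ (incl hA (v τ)) (x : H)) = fun τ => L (pivot hA (incl hA (v τ))) := by
    funext τ
    rw [hLp]
  have hye : ∀ t ∈ Ico 0 T, RightRLExists (ν * (1 - μ)) T
      (fun τ => inner ℝ (incl hA (v τ)) (x : H)) t := by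
    intro t ht
    rw [hy]
    exact (hv.integral_exists t ht).clm_comp (L ∘L pivot hA)
  have hrl : ∀ t ∈ Ico 0 T, rightRL (ν * (1 - μ)) T (fun τ => inner ℝ (incl hA (v τ)) (x : H)) t
      = inner ℝ (rightRL (ν * (1 - μ)) T (fun τ => incl hA (v τ)) t) (x : H) := by
    intro t ht
    rw [hy, ← hLp]
    exact rightRL_clm_comp ht.2.le (hv.integral_exists t ht) (L ∘L pivot hA)
  refine eq_mlFun_of_scalar_equation (a := (1 - ν) * (1 - μ)) (b := ν * (1 - μ))
    (γ := fun τ => L (g τ)) hT (mul_nonneg (by linarith) (by linarith))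
    (mul_nonneg hν0 (by linarith)) hμ0 (by ring) ?_ hye ?_ ?_ ?_
  · exact ((incl hA).continuous.comp_continuousOn hv.continuousOn).inner continuousOn_const
  · refine (hv.final.inner tendsto_const_nhds).congr' ?_
    filter_upwards [Ioo_mem_nhdsLT hT] with t ht
    exact (hrl t ⟨ht.1.le, ht.2⟩).symm
  · intro s t hs hst ht
    obtain ⟨h1, h2⟩ := hg s t hs hst ht
    refine ⟨intervalIntegrable_clm_comp L h1, ?_⟩
    rw [intervalIntegral_clm_comp L h1, ← h2, map_sub, hy,
      rightRL_clm_comp ht.le (hDe t ⟨hs.trans_le hst, ht⟩) L,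
      rightRL_clm_comp (hst.trans ht.le) (hDe s ⟨hs, hst.trans_lt ht⟩) L]
  · filter_upwards [hDg, hDeq (ofDomain hA x), ae_restrict_mem measurableSet_Ioo] with t h1 h2 ht
    refine ⟨h1.1.clm_comp L, ?_⟩
    rw [rightRL_clm_comp ht.2.le h1.1 L]
    rw [form_ofDomain_right, hx, real_inner_smul_right] at h2
    rw [← hL, h1.2, map_neg] at h2
    linarith

end

section

/-! ### Existence of weak solutions -/

variable {H : Type u} [NormedAddCommGroup H] [InnerProductSpace ℝ H] [CompleteSpace H]
  {A : H →ₗ.[ℝ] H} {μ ν T : ℝ} {v₀ : H}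

lemma formDual_ext {hA : IsAdmissible A} {ι : Type*} (e : HilbertBasis ι ℝ (FormDomain hA))
    {F G : FormDual hA} (h : ∀ i, F (e i) = G (e i)) : F = G := by
  ext x
  have h1 := (e.hasSum_repr x).mapL F
  have h2 := (e.hasSum_repr x).mapL G
  simp only [map_smul, h] at h1 h2
  exact h1.unique h2

lemma RightRLExists.pivot {b t : ℝ} {u : ℝ → H} (h : RightRLExists b T u t)
    (hA : IsAdmissible A) :
    RightRLExists b T (fun τ => HilferAdjoint.pivot hA (u τ)) t := by
  have := RightRLExists.clm_comp (Y := FormDual hA) h (HilferAdjoint.pivot hA)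
  exact this

lemma rightRL_pivot {b t : ℝ} {u : ℝ → H} (hA : IsAdmissible A) (ht : t ≤ T)
    (h : RightRLExists b T u t) :
    rightRL b T (fun τ => pivot hA (u τ)) t = pivot hA (rightRL b T u t) := by
  have := rightRL_clm_comp (Y := FormDual hA) ht h (pivot hA)
  exact this

lemma sqrt_one_add_le {x : ℝ} (hx : 0 ≤ x) : √(1 + x) ≤ 1 + √x := by
  rw [Real.sqrt_le_left (by positivity)]
  nlinarith [Real.sq_sqrt hx, Real.sqrt_nonneg x]

lemma div_sqrt_one_add_le {x : ℝ} (hx : 0 ≤ x) : x / √(1 + x) ≤ √x := by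
  rw [div_le_iff₀ (Real.sqrt_pos.2 (by linarith)), ← Real.sqrt_mul hx]
  refine Real.le_sqrt_of_sq_le ?_
  nlinarith

section Series

variable {ι V : Type*} [NormedAddCommGroup V] [InnerProductSpace ℝ V] [CompleteSpace V]
  {lam c : ι → ℝ} {b : ℝ}

/-- A function with the coefficients `c i (T - t) ^ (-b) E_{μ,1-b}(-lam i (T - t) ^ μ)` has a
fractional integral of order `b` that is continuous up to `T`. -/
theorem rightRL_of_inner_eq (φ : HilbertBasis ι ℝ H) (hlam : ∀ i, 0 ≤ lam i) (hb0 : 0 ≤ b)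
    (hb1 : b < 1) (hμ0 : 0 < μ) (hμ1 : μ ≤ 1) {u : ℝ → H} (huc : ContinuousOn u (Iio T))
    (huφ : ∀ t < T, ∀ i, inner ℝ (u t) (φ i)
      = inner ℝ v₀ (φ i) * mlFun μ (1 - b) (lam i) (T - t)) :
    (∀ t < T, RightRLExists b T u t) ∧ ContinuousOn (rightRL b T u) (Iio T) ∧
      Tendsto (rightRL b T u) (𝓝[<] T) (𝓝 v₀) ∧
      ∀ t < T, ∀ i, inner ℝ (rightRL b T u t) (φ i)
        = inner ℝ v₀ (φ i) * mlFun μ 1 (lam i) (T - t) := by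
  have h1b : 0 < 1 - b := by linarith
  have hcs : Summable fun i => ‖inner ℝ v₀ (φ i)‖ ^ 2 := summable_norm_inner_sq φ v₀
  obtain ⟨C₁, hC₁, hB₁⟩ := exists_abs_mlFun_le hμ0 hμ1 h1b
  obtain ⟨C₄, hC₄, hB₄⟩ := exists_abs_mlFun_le hμ0 hμ1 one_pos
  have hun : ∀ t ∈ Iio T, ‖u t‖
      ≤ (C₁ * √(∑' i, ‖inner ℝ v₀ (φ i)‖ ^ 2)) * (T - t) ^ (1 - b - 1) := by
    intro t ht
    have hs : 0 < T - t := sub_pos.2 ht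
    have hbd : ∀ i, ‖mlFun μ (1 - b) (lam i) (T - t)‖ ≤ C₁ * (T - t) ^ (1 - b - 1) :=
      fun i => hB₁ _ _ (hlam i) hs.le
    have h1 : u t = ∑' i, (inner ℝ v₀ (φ i) * mlFun μ (1 - b) (lam i) (T - t)) • φ i := by
      refine hilbertBasis_ext φ fun i => ?_
      rw [huφ t ht, inner_tsum_smul φ.orthonormal (summable_multiplier
        (f := fun i t => mlFun μ (1 - b) (lam i) (T - t)) φ.orthonormal hcs hbd)]
    rw [h1]
    refine (norm_tsum_multiplier_le (f := fun i t => mlFun μ (1 - b) (lam i) (T - t))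
      φ.orthonormal hcs (by positivity) hbd).trans (le_of_eq ?_)
    ring
  have hue : ∀ t < T, RightRLExists b T u t := fun t ht =>
    rightRLExists_of_norm_le hb0 h1b ht (huc.mono fun τ hτ => hτ.2) fun τ hτ => hun τ hτ.2
  have hfwb : ∀ t ∈ Iic T, ∀ i, ‖mlFun μ 1 (lam i) (T - t)‖ ≤ C₄ := by
    intro t ht i
    have h1 := hB₄ (lam i) (T - t) (hlam i) (sub_nonneg.2 ht)
    rwa [sub_self, Real.rpow_zero, mul_one] at h1
  have hfwc : ∀ i, ContinuousOn (fun t => mlFun μ 1 (lam i) (T - t)) (Iic T) := fun i =>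
    ((continuous_mlFun_one hμ0 (lam i)).comp
      (by fun_prop : Continuous fun t : ℝ => T - t)).continuousOn
  -- The candidate for `I^b u`. Its multipliers `E_{μ,1}` stay bounded up to `T`, unlike those of
  -- `u`, so it is continuous at `T` as well.
  set w : ℝ → H := fun t => ∑' i, (inner ℝ v₀ (φ i) * mlFun μ 1 (lam i) (T - t)) • φ i with hw
  have hwc : ContinuousOn w (Iic T) :=
    continuousOn_tsum_multiplier φ.orthonormal hcs hfwc
      (exists_local_bound (g := fun _ => C₄) continuousOn_const hfwb)
  have hwφ : ∀ t ∈ Iic T, ∀ i, inner ℝ (w t) (φ i)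
      = inner ℝ v₀ (φ i) * mlFun μ 1 (lam i) (T - t) := fun t ht i =>
    inner_tsum_smul φ.orthonormal (summable_multiplier
      (f := fun i t => mlFun μ 1 (lam i) (T - t)) φ.orthonormal hcs (hfwb t ht)) i
  have hwT : w T = v₀ := by
    refine hilbertBasis_ext φ fun i => ?_
    rw [hwφ T self_mem_Iic, sub_self, mlFun_one_zero hμ0, mul_one]
  have hrw : ∀ t < T, rightRL b T u t = w t := by
    intro t ht
    refine hilbertBasis_ext φ fun i => ?_
    have h1 := rightRL_clm_comp ht.le (hue t ht) (innerSL ℝ (φ i))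
    rw [innerSL_apply_apply] at h1
    rw [real_inner_comm, ← h1, hwφ t ht.le, rightRL_congr ht
      (g := fun τ => inner ℝ v₀ (φ i) * mlFun μ (1 - b) (lam i) (T - τ)) (fun τ hτ => by
        simp only
        rw [innerSL_apply_apply, real_inner_comm, huφ τ hτ.2]), rightRL_const_mul,
      rightRL_mlFun hb0 h1b hμ0 ht, add_sub_cancel]
  refine ⟨hue, (hwc.mono Iio_subset_Iic_self).congr fun t ht => hrw t ht, ?_, fun t ht i => ?_⟩
  · have h1 : Tendsto w (𝓝[<] T) (𝓝 (w T)) :=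
      (hwc T self_mem_Iic).tendsto.mono_left (nhdsWithin_mono _ Iio_subset_Iic_self)
    rw [hwT] at h1
    refine h1.congr' ?_
    filter_upwards [self_mem_nhdsWithin] with t ht
    exact (hrw t ht).symm
  · rw [hrw t ht, hwφ t ht.le]

/-- The series of the solution in the form domain. -/
theorem exists_solution_series {e : ι → V} (he : Orthonormal ℝ e)
    (hc : Summable fun i => ‖c i‖ ^ 2) (hlam : ∀ i, 0 ≤ lam i) (hbμ : b ≤ 1 - μ) (hμ0 : 0 < μ)
    (hμ1 : μ ≤ 1) (T : ℝ) :
    ∃ v : ℝ → V, ContinuousOn v (Iio T) ∧ ∀ t < T, ∀ i,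
      inner ℝ (v t) (e i) = c i * (√(1 + lam i) * mlFun μ (1 - b) (lam i) (T - t)) := by
  have h1b : 0 < 1 - b := by linarith
  obtain ⟨C₁, hC₁, hB₁⟩ := exists_abs_mlFun_le hμ0 hμ1 h1b
  obtain ⟨C₂, hC₂, hB₂⟩ := exists_sqrt_mul_abs_mlFun_le hμ0 hμ1
    -- From `b ≤ 1 - μ` one has `1 - b ≥ μ`, so the square-root decay is available.
    (show μ / 2 < 1 - b by linarith)
  have hfb : ∀ t ∈ Iio T, ∀ i, ‖√(1 + lam i) * mlFun μ (1 - b) (lam i) (T - t)‖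
      ≤ C₁ * (T - t) ^ (1 - b - 1) + C₂ * (T - t) ^ (1 - b - μ / 2 - 1) := by
    intro t ht i
    have hs : 0 < T - t := sub_pos.2 ht
    rw [norm_mul, Real.norm_of_nonneg (Real.sqrt_nonneg _), Real.norm_eq_abs]
    calc √(1 + lam i) * |mlFun μ (1 - b) (lam i) (T - t)|
        ≤ (1 + √(lam i)) * |mlFun μ (1 - b) (lam i) (T - t)| := by
          gcongr
          exact sqrt_one_add_le (hlam i)
      _ = |mlFun μ (1 - b) (lam i) (T - t)| + √(lam i) * |mlFun μ (1 - b) (lam i) (T - t)| := by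
          ring
      _ ≤ _ := add_le_add (hB₁ _ _ (hlam i) hs.le) (hB₂ _ _ (hlam i) hs)
  refine ⟨fun t => ∑' i, (c i * (√(1 + lam i) * mlFun μ (1 - b) (lam i) (T - t))) • e i, ?_, ?_⟩
  · exact continuousOn_tsum_multiplier he hc
      (fun i => continuousOn_const.mul (continuousOn_mlFun_sub hμ0 h1b _ T))
      (exists_local_bound ((continuousOn_const.mul (continuousOn_sub_rpow T _)).add
        (continuousOn_const.mul (continuousOn_sub_rpow T _))) hfb)
  · exact fun t ht i => inner_tsum_smul he (summable_multiplier
      (f := fun i t => √(1 + lam i) * mlFun μ (1 - b) (lam i) (T - t)) he hc (hfb t ht)) i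

/-- The series of the derivative of the fractional integral of the solution. -/
theorem exists_derivative_series {e : ι → V} (he : Orthonormal ℝ e)
    (hc : Summable fun i => ‖c i‖ ^ 2) (hlam : ∀ i, 0 ≤ lam i) (hμ0 : 0 < μ) (hμ1 : μ ≤ 1)
    (T : ℝ) :
    ∃ (G : ℝ → V) (C : ℝ), ContinuousOn G (Iio T) ∧
      (∀ t < T, ‖G t‖ ≤ C * (T - t) ^ (μ / 2 - 1)) ∧
      ∀ t < T, ∀ i,
        inner ℝ (G t) (e i) = c i * (lam i / √(1 + lam i) * mlFun μ μ (lam i) (T - t)) := by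
  -- The multiplier `lam / √(1+lam)` is `lam` measured in the dual norm. It is at most `√lam`, which
  -- leaves the integrable singularity `(T-t)^(μ/2-1)`.
  obtain ⟨C₃, hC₃, hB₃⟩ := exists_sqrt_mul_abs_mlFun_le hμ0 hμ1 (show μ / 2 < μ by linarith)
  have hfb : ∀ t ∈ Iio T, ∀ i, ‖lam i / √(1 + lam i) * mlFun μ μ (lam i) (T - t)‖
      ≤ C₃ * (T - t) ^ (μ / 2 - 1) := by
    intro t ht i
    have hs : 0 < T - t := sub_pos.2 ht
    have h2 : 0 ≤ lam i / √(1 + lam i) := div_nonneg (hlam i) (Real.sqrt_nonneg _)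
    rw [norm_mul, Real.norm_of_nonneg h2, Real.norm_eq_abs]
    calc lam i / √(1 + lam i) * |mlFun μ μ (lam i) (T - t)|
        ≤ √(lam i) * |mlFun μ μ (lam i) (T - t)| := by
          gcongr
          exact div_sqrt_one_add_le (hlam i)
      _ ≤ C₃ * (T - t) ^ (μ - μ / 2 - 1) := hB₃ _ _ (hlam i) hs
      _ = _ := by rw [sub_half]
  refine ⟨fun t => ∑' i, (c i * (lam i / √(1 + lam i) * mlFun μ μ (lam i) (T - t))) • e i,
    C₃ * √(∑' i, ‖c i‖ ^ 2), ?_, ?_, ?_⟩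
  · exact continuousOn_tsum_multiplier he hc
      (fun i => continuousOn_const.mul (continuousOn_mlFun_sub hμ0 hμ0 _ T))
      (exists_local_bound (continuousOn_const.mul (continuousOn_sub_rpow T _)) hfb)
  · intro t ht
    have hs : 0 < T - t := sub_pos.2 ht
    refine (norm_tsum_multiplier_le
      (f := fun i t => lam i / √(1 + lam i) * mlFun μ μ (lam i) (T - t)) he hc (by positivity)
      (hfb t ht)).trans (le_of_eq ?_)
    ring
  · exact fun t ht i => inner_tsum_smul he (summable_multiplier
      (f := fun i t => lam i / √(1 + lam i) * mlFun μ μ (lam i) (T - t)) he hc (hfb t ht)) i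

/-- The right Hilfer derivative, computed by testing with a separating family of functionals. -/
theorem hasRightHilferDeriv_of_forall_functional {E : Type*} [NormedAddCommGroup E]
    [NormedSpace ℝ E] [CompleteSpace E] {L : ι → E →L[ℝ] ℝ}
    (hL : ∀ x y : E, (∀ i, L i x = L i y) → x = y) (hν1 : ν ≤ 1) (hμ0 : 0 < μ)
    (hμ1 : μ ≤ 1) {u G D : ℝ → E} {C : ℝ}
    (hu : ∀ t < T, RightRLExists (ν * (1 - μ)) T u t)
    (huL : ∀ t < T, ∀ i, L i (rightRL (ν * (1 - μ)) T u t) = c i * mlFun μ 1 (lam i) (T - t))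
    (hGc : ContinuousOn G (Iio T)) (hGn : ∀ t < T, ‖G t‖ ≤ C * (T - t) ^ (μ / 2 - 1))
    (hGL : ∀ t < T, ∀ i, L i (G t) = c i * lam i * mlFun μ μ (lam i) (T - t))
    (hDL : ∀ t < T, ∀ i,
      L i (D t) = -(c i * lam i * mlFun μ (1 - ν * (1 - μ)) (lam i) (T - t))) :
    HasRightHilferDeriv μ (1 - ν) T u D := by
  have hb' : (1 - (1 - ν)) * (1 - μ) = ν * (1 - μ) := by ring
  have ha0 : 0 ≤ (1 - ν) * (1 - μ) := mul_nonneg (by linarith) (by linarith)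
  rw [HasRightHilferDeriv, hb']
  refine ⟨fun t ht => hu t ht.2, G, ?_, ?_⟩
  · intro s t hs hst ht
    have hi : IntervalIntegrable G volume s t :=
      ContinuousOn.intervalIntegrable_of_Icc hst (hGc.mono fun τ hτ => hτ.2.trans_lt ht)
    refine ⟨hi, hL _ _ fun i => ?_⟩
    have h1 : ∫ τ in s..t, L i (G τ)
        = ∫ τ in s..t, c i * lam i * mlFun μ μ (lam i) (T - τ) := by
      refine intervalIntegral.integral_congr fun τ hτ => ?_
      rw [uIcc_of_le hst] at hτ
      exact hGL τ (hτ.2.trans_lt ht) i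
    rw [← intervalIntegral_clm_comp (L i) hi, h1, map_sub, huL t ht, huL s (hst.trans_lt ht),
      intervalIntegral.integral_const_mul, ← mul_sub, mlFun_one_sub hμ0 hst ht]
    ring
  · filter_upwards [ae_restrict_mem measurableSet_Ioo] with t ht
    have hex : RightRLExists ((1 - ν) * (1 - μ)) T G t :=
      rightRLExists_of_norm_le ha0 (half_pos hμ0) ht.2 (hGc.mono fun τ hτ => hτ.2)
        fun τ hτ => hGn τ hτ.2
    refine ⟨hex, hL _ _ fun i => ?_⟩
    -- `I^a` raises the second index from `μ` to `a + μ = 1 - b`, that of the solution.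
    have h1 : L i (rightRL ((1 - ν) * (1 - μ)) T G t)
        = c i * lam i * mlFun μ (1 - ν * (1 - μ)) (lam i) (T - t) := by
      rw [← rightRL_clm_comp ht.2.le hex (L i), rightRL_congr ht.2
        (g := fun τ => c i * lam i * mlFun μ μ (lam i) (T - τ))
        (fun τ hτ => hGL τ hτ.2 i), rightRL_const_mul, rightRL_mlFun ha0 hμ0 hμ0 ht.2]
      congr 2
      ring
    rw [map_neg, h1, hDL t ht.2]

end Series

/-- The backward system has a weak solution. -/
theorem exists_isWeakSolution (hA : IsAdmissible A) (hν0 : 0 ≤ ν) (hν1 : ν ≤ 1) (hμ0 : 0 < μ)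
    (hμ1 : μ ≤ 1) (v₀ : H) : ∃ v, IsWeakSolution hA μ ν T v₀ v := by
  obtain ⟨ι, lam, φ, hφ⟩ := exists_hilbertBasis_eigenvectors hA
  obtain ⟨e, heincl, heinner⟩ := exists_formBasis hA hφ
  have hlam : ∀ i, 0 ≤ lam i := fun i => (eigenvalue_pos_of_basis hA hφ i).le
  have hsq : ∀ i, 0 < √(1 + lam i) := fun i => Real.sqrt_pos.2 (by linarith [hlam i])
  have hb0 : 0 ≤ ν * (1 - μ) := mul_nonneg hν0 (by linarith)
  have hbμ : ν * (1 - μ) ≤ 1 - μ := mul_le_of_le_one_left (by linarith) hν1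
  have hcs := summable_norm_inner_sq φ v₀
  obtain ⟨v, hvc, hve⟩ := exists_solution_series e.orthonormal hcs hlam hbμ hμ0 hμ1 T
  obtain ⟨G, C, hGc, hGn, hGe⟩ := exists_derivative_series e.orthonormal hcs hlam hμ0 hμ1 T
  have hvφ : ∀ t < T, ∀ i, inner ℝ (incl hA (v t)) (φ i)
      = inner ℝ v₀ (φ i) * mlFun μ (1 - ν * (1 - μ)) (lam i) (T - t) := by
    intro t ht i
    have h1 := hve t ht i
    rw [heinner] at h1
    refine mul_left_cancel₀ (hsq i).ne' (h1.trans ?_)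
    ring
  have huc : ContinuousOn (fun t => incl hA (v t)) (Iio T) :=
    (incl hA).continuous.comp_continuousOn hvc
  obtain ⟨hue, hwc, hwT, hwφ⟩ := rightRL_of_inner_eq φ hlam hb0 (by linarith) hμ0 hμ1 huc hvφ
  -- `J` is the Riesz isometry of `V_{1/2}` into its dual; it carries the series `G` into
  -- `V_{-1/2}`.
  obtain ⟨J, hJ, hJn⟩ : ∃ J : FormDomain hA →L[ℝ] FormDual hA,
      (∀ x y, J x y = inner ℝ x y) ∧ ∀ x, ‖J x‖ = ‖x‖ :=
    ⟨innerSL ℝ, fun x y => innerSL_apply_apply ℝ x y, fun x => innerSL_apply_norm ℝ x⟩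
  have hev : ∀ i, ∃ L : FormDual hA →L[ℝ] ℝ, ∀ F, L F = F (e i) := fun i =>
    ⟨ContinuousLinearMap.apply ℝ ℝ (e i), fun _ => rfl⟩
  choose L hL using hev
  have hne := fun i => (hsq i).ne'
  have hmul : ∀ i, √(1 + lam i) * √(1 + lam i) = 1 + lam i := fun i =>
    Real.mul_self_sqrt (by linarith [hlam i])
  -- This functional is `-𝓔(v(t), ·)`, since `𝓔` is the form inner product minus that of `H`. With
  -- it the weak equation is an identity, and what remains is that it is the Hilfer derivative.
  have hDc : ContinuousOn (fun t => pivot hA (incl hA (v t)) - J (v t)) (Iio T) :=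
    ((pivot hA).continuous.comp_continuousOn huc).sub (J.continuous.comp_continuousOn hvc)
  refine ⟨v, hvc.mono fun t ht => ht.2, fun t ht => hue t ht.2, hwc.mono fun t ht => ht.2, hwT,
    fun t => pivot hA (incl hA (v t)) - J (v t), ?_, hDc.mono fun t ht => ht.2, ?_⟩
  · refine hasRightHilferDeriv_of_forall_functional (L := L) (G := fun t => J (G t)) (lam := lam)
      (c := fun i => (√(1 + lam i))⁻¹ * inner ℝ v₀ (φ i)) (C := C) ?_ hν1 hμ0 hμ1 ?_ ?_
      (J.continuous.comp_continuousOn hGc) ?_ ?_ ?_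
    · exact fun x y h => formDual_ext e fun i => by rw [← hL, ← hL, h]
    · exact fun t ht => (hue t ht).pivot hA
    · intro t ht i
      rw [rightRL_pivot hA ht.le (hue t ht), hL, pivot_apply, heincl,
        real_inner_smul_right, hwφ t ht]
      ring
    · exact fun t ht => by rw [hJn]; exact hGn t ht
    · intro t ht i
      rw [hL, hJ, hGe t ht]
      ring
    · intro t ht i
      rw [hL, _root_.sub_apply, pivot_apply, hJ, hve t ht, heincl,
        real_inner_smul_right, hvφ t ht]
      have h3 := hne i
      field_simp
      linear_combination
        -(inner ℝ v₀ (φ i) * mlFun μ (1 - ν * (1 - μ)) (lam i) (T - t)) * hmul i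
  · refine fun ψ => Eventually.of_forall fun t => ?_
    rw [_root_.sub_apply, pivot_apply, hJ, form]
    ring

/-- Weak solutions are unique on `[0, T)`. -/
theorem IsWeakSolution.eqOn {hA : IsAdmissible A} {v v' : ℝ → FormDomain hA}
    (hv : IsWeakSolution hA μ ν T v₀ v) (hv' : IsWeakSolution hA μ ν T v₀ v') (hT : 0 < T)
    (hν0 : 0 ≤ ν) (hν1 : ν ≤ 1) (hμ0 : 0 < μ) (hμ1 : μ ≤ 1) : EqOn v' v (Ico 0 T) := by
  obtain ⟨ι, lam, φ, hφ⟩ := exists_hilbertBasis_eigenvectors hA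
  intro t ht
  refine incl_injective hA (hilbertBasis_ext φ fun i => ?_)
  obtain ⟨h, h'⟩ := hφ i
  exact (hv'.inner_eigenvector hT hν0 hν1 hμ0 hμ1 h' t ht).trans
    (hv.inner_eigenvector hT hν0 hν1 hμ0 hμ1 h' t ht).symm

/-- The series representation of a weak solution. -/
theorem IsWeakSolution.hasSum {hA : IsAdmissible A} {v : ℝ → FormDomain hA}
    (hv : IsWeakSolution hA μ ν T v₀ v) (hT : 0 < T) (hν0 : 0 ≤ ν) (hν1 : ν ≤ 1) (hμ0 : 0 < μ)
    (hμ1 : μ ≤ 1) {ι : Type*} {lam : ι → ℝ} {φ : HilbertBasis ι ℝ H}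
    (hφ : ∀ i, ∃ h : φ i ∈ A.domain, A ⟨φ i, h⟩ = lam i • φ i) {t : ℝ} (ht : t ∈ Ico 0 T) :
    HasSum (fun i => (inner ℝ v₀ (φ i) * mlFun μ (1 - ν * (1 - μ)) (lam i) (T - t)) • φ i)
      (incl hA (v t)) := by
  refine (φ.hasSum_repr (incl hA (v t))).congr_fun fun i => ?_
  obtain ⟨h, h'⟩ := hφ i
  rw [φ.repr_apply_apply, real_inner_comm (incl hA (v t)),
    hv.inner_eigenvector hT hν0 hν1 hμ0 hμ1 h' t ht]

end

section

/-! ### The analytic extension -/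

section Complexification

variable {N : ℕ} (Ω : Set (EuclideanSpace ℝ (Fin N)))

/-- The embedding `L²(Ω) ⊆ L²(Ω; ℂ)` as a continuous linear map. -/
def complexifyCLM : L2 Ω →L[ℝ] L2C Ω :=
  Complex.ofRealCLM.compLpL 2 (volume.restrict Ω)

lemma complexifyCLM_apply (f : L2 Ω) : complexifyCLM Ω f = complexify Ω f := rfl

lemma coeFn_complexify (f : L2 Ω) :
    ∀ᵐ x ∂(volume.restrict Ω), complexify Ω f x = ((f x : ℝ) : ℂ) :=
  Complex.ofRealCLM.coeFn_compLp f

lemma inner_complexify (f g : L2 Ω) :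
    inner ℂ (complexify Ω f) (complexify Ω g) = ((inner ℝ f g : ℝ) : ℂ) := by
  rw [L2.inner_def, L2.inner_def, ← integral_complex_ofReal]
  refine integral_congr_ae ?_
  filter_upwards [coeFn_complexify Ω f, coeFn_complexify Ω g] with x hf hg
  rw [hf, hg]
  simp

lemma orthonormal_complexify {ι : Type*} {φ : ι → L2 Ω} (hφ : Orthonormal ℝ φ) :
    Orthonormal ℂ fun i => complexify Ω (φ i) := by
  classical
  rw [orthonormal_iff_ite] at hφ ⊢
  intro i j
  rw [inner_complexify, hφ]
  split_ifs <;> simp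

lemma complexify_smul (r : ℝ) (f : L2 Ω) :
    complexify Ω (r • f) = (r : ℂ) • complexify Ω f := by
  rw [← complexifyCLM_apply, map_smul, complexifyCLM_apply]
  exact RCLike.real_smul_eq_coe_smul (K := ℂ) r (complexify Ω f)

end Complexification

/-! ### The scalar solutions on the right half-plane -/

variable {μ β T lam : ℝ}

/-- The function `w ↦ w ^ (β - 1) E_{μ,β}(-lam w ^ μ)` of a complex variable. -/
def mlFunC (μ β lam : ℝ) (w : ℂ) : ℂ :=
  w ^ ((β - 1 : ℝ) : ℂ) * mittagLefflerC μ β (-((lam : ℂ) * w ^ (μ : ℂ)))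

lemma mlFunC_ofReal (μ β lam : ℝ) {s : ℝ} (hs : 0 ≤ s) :
    mlFunC μ β lam (s : ℂ) = (mlFun μ β lam s : ℂ) := by
  rw [mlFunC, mlFun, ← Complex.ofReal_cpow hs, ← Complex.ofReal_cpow hs, ← Complex.ofReal_mul,
    ← Complex.ofReal_neg, mittagLefflerC_ofReal, ← Complex.ofReal_mul, neg_mul]

lemma differentiableOn_mlFunC (hμ : 0 < μ) (hβ : 0 < β) (lam : ℝ) :
    DifferentiableOn ℂ (mlFunC μ β lam) {w | 0 < w.re} := by
  intro w hw
  have hw : w ∈ Complex.slitPlane := Or.inl hw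
  have h : ∀ a : ℂ, DifferentiableAt ℂ (fun w : ℂ => w ^ a) w := fun a =>
    ((hasDerivAt_id w).cpow_const hw).differentiableAt
  have h2 : DifferentiableAt ℂ
      (fun w : ℂ => mittagLefflerC μ β (-((lam : ℂ) * w ^ (μ : ℂ)))) w :=
    (differentiable_mittagLefflerC hμ hβ _).comp w ((h _).const_mul _).neg
  exact ((h _).mul h2).differentiableWithinAt

/-- The functions `mlFunC μ β lam`, `0 ≤ lam`, are locally uniformly bounded on the right
half-plane. -/
lemma exists_local_bound_mlFunC {ι : Type*} {lam : ι → ℝ} (hlam : ∀ i, 0 ≤ lam i) (hμ : 0 < μ)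
    (hμ1 : μ ≤ 1) (hβ : 0 < β) {w₀ : ℂ} (hw₀ : 0 < w₀.re) :
    ∃ M, ∀ᶠ w in 𝓝 w₀, ∀ i, ‖mlFunC μ β (lam i) w‖ ≤ M := by
  -- The slack `1` keeps a neighbourhood of `w₀` in the sector `‖w‖ ≤ K Re w`. Then `lam w^μ`
  -- satisfies the same inequality for every `lam ≥ 0`, so the bound does not depend on the index.
  set K := ‖w₀‖ / w₀.re + 1 with hK
  have hK0 : 0 ≤ K := by positivity
  obtain ⟨C, hC, hbd⟩ := exists_norm_mittagLefflerC_neg_le hμ hμ1 hβ hK0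
  have hw0 : w₀ ≠ 0 := by
    rintro rfl
    simp at hw₀
  have h1 : ∀ᶠ w in 𝓝 w₀, 0 < w.re := Complex.continuous_re.continuousAt.eventually_const_lt hw₀
  have h2 : ∀ᶠ w in 𝓝 w₀, ‖w‖ / w.re < K := by
    have : ContinuousAt (fun w : ℂ => ‖w‖ / w.re) w₀ :=
      continuous_norm.continuousAt.div Complex.continuous_re.continuousAt hw₀.ne'
    exact this.eventually_lt_const (by rw [hK]; linarith)
  have h3 : ∀ᶠ w in 𝓝 w₀, ‖w‖ ^ (β - 1) < ‖w₀‖ ^ (β - 1) + 1 := by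
    have : ContinuousAt (fun w : ℂ => ‖w‖ ^ (β - 1)) w₀ :=
      ContinuousAt.rpow_const continuous_norm.continuousAt (Or.inl (norm_pos_iff.2 hw0).ne')
    exact this.eventually_lt_const (by linarith)
  refine ⟨(‖w₀‖ ^ (β - 1) + 1) * C, ?_⟩
  filter_upwards [h1, h2, h3] with w hw1 hw2 hw3 i
  have hwn : 0 < ‖w‖ := by
    rw [norm_pos_iff]
    rintro rfl
    simp at hw1
  rw [mlFunC, norm_mul, Complex.norm_cpow_real]
  gcongr
  refine hbd _ ?_
  have h4 := le_re_cpow hw1 hμ.le hμ1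
  rw [Complex.re_ofReal_mul, norm_mul, Complex.norm_real, Real.norm_of_nonneg (hlam i),
    mul_left_comm]
  refine mul_le_mul_of_nonneg_left ?_ (hlam i)
  calc ‖w ^ (μ : ℂ)‖ = ‖w‖ / w.re * (w.re / ‖w‖ * ‖w ^ (μ : ℂ)‖) := by field_simp
    _ ≤ K * (w ^ (μ : ℂ)).re := by gcongr

/-- An orthogonal series with the coefficients `c i (T - t) ^ (β - 1) E_{μ,β}(-lam i (T - t) ^ μ)`
extends to an analytic function on the half-plane `Re z < T`. -/
theorem exists_analytic_extension {N : ℕ} {Ω : Set (EuclideanSpace ℝ (Fin N))} {ι : Type*}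
    {lam c : ι → ℝ} {φ : ι → L2 Ω} (hφ : Orthonormal ℝ φ) (hc : Summable fun i => ‖c i‖ ^ 2)
    (hlam : ∀ i, 0 ≤ lam i) (hμ : 0 < μ) (hμ1 : μ ≤ 1) (hβ : 0 < β) (T : ℝ) :
    ∃ V : ℂ → L2C Ω, AnalyticOnNhd ℂ V {z : ℂ | z.re < T} ∧
      ∀ t < T, ∀ x : L2 Ω, HasSum (fun i => (c i * mlFun μ β (lam i) (T - t)) • φ i) x →
        V (t : ℂ) = complexify Ω x := by
  have hopen : IsOpen {z : ℂ | z.re < T} := isOpen_lt Complex.continuous_re continuous_const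
  refine ⟨fun z => ∑' i, ((c i : ℂ) * mlFunC μ β (lam i) (T - z)) • complexify Ω (φ i), ?_, ?_⟩
  · refine DifferentiableOn.analyticOnNhd ?_ hopen
    refine differentiableOn_tsum_multiplier (c := fun i => (c i : ℂ))
      (f := fun i z => mlFunC μ β (lam i) (T - z)) (orthonormal_complexify Ω hφ) ?_ hopen ?_ ?_
    · simpa using hc
    · intro i
      refine (differentiableOn_mlFunC hμ hβ (lam i)).comp (by fun_prop) fun z hz => ?_
      have hz : z.re < T := hz
      simpa using hz
    · intro z₀ hz₀
      have hz₀ : z₀.re < T := hz₀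
      obtain ⟨M, hM⟩ := exists_local_bound_mlFunC hlam hμ hμ1 hβ
        (w₀ := (T : ℂ) - z₀) (by simpa using hz₀)
      have hcont : ContinuousAt (fun z : ℂ => (T : ℂ) - z) z₀ := by fun_prop
      exact ⟨M, _, mem_nhdsWithin_of_mem_nhds (hcont.eventually hM), fun z hz => hz⟩
  · intro t ht x hx
    have h := hx.mapL (complexifyCLM Ω)
    rw [complexifyCLM_apply] at h
    refine HasSum.tsum_eq (h.congr_fun fun i => ?_)
    rw [complexifyCLM_apply, complexify_smul, ← Complex.ofReal_sub,
      mlFunC_ofReal _ _ _ (sub_pos.2 ht).le, Complex.ofReal_mul]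

end

end HilferAdjoint

end

/-! ### The theorem -/

theorem mainTheorem5 {N : ℕ} (hN : 1 ≤ N) (Ω : Set (EuclideanSpace ℝ (Fin N)))
    (hΩo : IsOpen Ω) (hΩb : Bornology.IsBounded Ω)
    (A : HilferAdjoint.L2 Ω →ₗ.[ℝ] HilferAdjoint.L2 Ω) (hA : HilferAdjoint.IsAdmissible A)
    (μ ν T : ℝ) (hν0 : 0 ≤ ν) (hν1 : ν ≤ 1) (hμ0 : 0 < μ) (hμ1 : μ ≤ 1) (hT : 0 < T)
    (v₀ : HilferAdjoint.L2 Ω) :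
    ∃ v : ℝ → HilferAdjoint.FormDomain hA,
      -- existence
      HilferAdjoint.IsWeakSolution hA μ ν T v₀ v ∧
      -- uniqueness
      (∀ v' : ℝ → HilferAdjoint.FormDomain hA,
        HilferAdjoint.IsWeakSolution hA μ ν T v₀ v' → Set.EqOn v' v (Set.Ico 0 T)) ∧
      -- the series representation in L²(Ω), for every orthonormal basis of eigenfunctions
      (∀ (lam : ℕ → ℝ) (φ : HilbertBasis ℕ ℝ (HilferAdjoint.L2 Ω)),
        HilferAdjoint.IsEigenbasis A lam φ → ∀ t ∈ Set.Ico 0 T,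
          HasSum (fun n : ℕ =>
            (inner ℝ v₀ (φ n) * (T - t) ^ (-(ν * (1 - μ))) *
              HilferAdjoint.mittagLeffler μ (1 - ν * (1 - μ)) (-lam n * (T - t) ^ μ)) • φ n)
            (HilferAdjoint.incl hA (v t))) ∧
      -- the analytic extension to the half-plane Re z < T
      ∃ V : ℂ → HilferAdjoint.L2C Ω,
        AnalyticOnNhd ℂ V {z : ℂ | z.re < T} ∧
        ∀ t ∈ Set.Ico 0 T, V (t : ℂ) = HilferAdjoint.complexify Ω (HilferAdjoint.incl hA (v t)) := by
  obtain ⟨v, hv⟩ := HilferAdjoint.exists_isWeakSolution (T := T) hA hν0 hν1 hμ0 hμ1 v₀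
  refine ⟨v, hv, fun v' hv' => hv.eqOn hv' hT hν0 hν1 hμ0 hμ1, ?_, ?_⟩
  · intro lam φ hφ t ht
    refine (hv.hasSum hT hν0 hν1 hμ0 hμ1 hφ ht).congr_fun fun n => ?_
    rw [HilferAdjoint.mlFun, mul_assoc]
    congr 4
    ring
  -- The extension is built from the basis of the spectral theorem, so it does not presuppose an
  -- eigenbasis indexed by `ℕ`.
  · obtain ⟨ι, lam, φ, hφ⟩ := HilferAdjoint.exists_hilbertBasis_eigenvectors hA
    have hb : ν * (1 - μ) ≤ 1 - μ := mul_le_of_le_one_left (by linarith) hν1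
    obtain ⟨V, hV, hVt⟩ := HilferAdjoint.exists_analytic_extension (μ := μ)
      (β := 1 - ν * (1 - μ)) φ.orthonormal (HilferAdjoint.summable_norm_inner_sq φ v₀)
      (fun i => (HilferAdjoint.eigenvalue_pos_of_basis hA hφ i).le) hμ0 hμ1 (by linarith) T
    exact ⟨V, hV, fun t ht => hVt t ht.2 _ (hv.hasSum hT hν0 hν1 hμ0 hμ1 hφ ht)⟩
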